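/- Let $\mathcal G$ be a maximal ancestral graph (MAG) with directed ($\to$) and bidirected ($\leftrightarrow$) edges on the vertex set $[n]=\{1,\dots,n\}$, where the numerical order is topological (ancestors come first). Write $\mathrm{pa},\mathrm{an},\mathrm{de},\mathrm{dis}$ for parents, ancestors, descendants and districts (a vertex is its own ancestor and descendant), applied to sets by taking unions, $\mathrm{dis}_A$, $\mathrm{pa}_A$ for those of the induced subgraph $\mathcal G_A$, and $\mathrm{barren}(W)=\{w\in W:\mathrm{de}(w)\cap W=\{w\}\}$. For a vertex $v$ of $A$ let $\mathrm{mb}(v,A)=(\mathrm{pa}_A(\mathrm{dis}_A(v))\cup\mathrm{dis}_A(v))\setminus\{v\}$. A nonempty set $H$ is a head, $H\in\mathcal H(\mathcal G)$, if $\mathrm{barren}(H)=H$ and $H$ lies in a single district of $\mathcal G_{\mathrm{an}(H)}$; its tail is $T=\mathrm{tail}(H)=(\mathrm{dis}_{\mathrm{an}(H)}(H)\setminus H)\cup\mathrm{pa}(\mathrm{dis}_{\mathrm{an}(H)}(H))$. Let $c_{\mathcal G}(S)=1$ if $S=\emptyset$ or $S=H\cup A$ for some head $H$ and $A\subseteq\mathrm{tail}(H)$,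 and $c_{\mathcal G}(S)=0$ otherwise; the standard imset of $\mathcal G$ is $$u_{\mathcal G}(B)=\sum_{B\subseteq A\subseteq[n]}(-1)^{|A\setminus B|}\,(1-c_{\mathcal G}(A)),\qquad B\subseteq[n].$$ For pairwise disjoint $A,B,C$ the semi-elementary imset is $u_{\langle A,B\mid C\rangle}=\delta_{A\cup B\cup C}-\delta_{A\cup C}-\delta_{B\cup C}+\delta_C$, where $\delta_A(B)=1$ if $B=A$ and $0$ otherwise; it is elementary if $A$ and $B$ are singletons. An imset is combinatorial if it is a nonnegative integer combination of elementary imsets. Write $H\le i$ if $i$ is the maximal vertex of $H$. For heads $H,H'$ with $H\le i$ and $\emptyset\ne K\subseteq H\setminus\{i\}$, write $H\to^K H'$ if $\mathrm{barren}_{\mathcal G'}(\mathrm{dis}_{\mathcal G'}(i))=H'$ for $\mathcal G'=\mathcal G_{\mathrm{an}(H)\setminus K}$; put $T'=\mathrm{tail}(H')$. Theorem. With these notations, $$u_{\mathcal G}=\sum_{i=1}^n\Bigl\{u_{\langle i,\,[i-1]\setminus\mathrm{mb}(i,[i])\,\mid\,\mathrm{mb}(i,[i])\rangle}+\sum_{\substack{H\in\mathcal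 H(\mathcal G)\setminus\{\{i\}\}\\H\le i}}\ \sum_{\substack{\emptyset\ne K\subseteq H\setminus\{i\}\\H\to^K H'}}(-1)^{|K|+1}\,u_{\langle i,\,(H\cup T)\setminus(H'\cup T'\cup K)\,\mid\,(H'\cup T')\setminus\{i\}\rangle}\Bigr\},$$ where every triple that occurs consists of pairwise disjoint sets. Consequently $\mathcal I_{u_{\mathcal G}}\subseteq\mathcal I_{\mathcal G}$: if $A,B,C\subseteq[n]$ are pairwise disjoint and $k\,u_{\mathcal G}-u_{\langle A,B\mid C\rangle}$ is combinatorial for some integer $k\ge1$, then $A$ and $B$ are m-separated by $C$ in $\mathcal G$. -/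

import Mathlib

/-- A mixed graph on the vertex set `V`: directed edges `a → b` and bidirected edges `a ↔ b`,
always between distinct vertices. -/
structure MixedGraph (V : Type*) where
  dir : V → V → Prop
  bidir : V → V → Prop
  dir_irrefl : ∀ a, ¬ dir a a
  bidir_irrefl : ∀ a, ¬ bidir a a
  bidir_symm : ∀ a b, bidir a b → bidir b a

namespace MixedGraph

section Graphs

variable {V : Type*} [Fintype V] [DecidableEq V]

/-- `a` and `b` are joined by an edge of some kind. -/
def Adj (G : MixedGraph V) (a b : V) : Prop :=
  G.dir a b ∨ G.dir b a ∨ G.bidir a b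

/-- Some edge between `a` and `b` has an arrowhead at `b`. -/
def Into (G : MixedGraph V) (a b : V) : Prop :=
  G.dir a b ∨ G.bidir a b

open Classical in
/-- The parents of a set of vertices. -/
noncomputable def pa (G : MixedGraph V) (W : Finset V) : Finset V :=
  Finset.univ.filter fun w => ∃ v ∈ W, G.dir w v

open Classical in
/-- The siblings of a set of vertices. -/
noncomputable def sib (G : MixedGraph V) (W : Finset V) : Finset V :=
  Finset.univ.filter fun w => ∃ v ∈ W, G.bidir w v

open Classical in
/-- The ancestors of a set of vertices (every vertex is its own ancestor). -/
noncomputable def an (G : MixedGraph V) (W : Finset V) : Finset V :=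
  Finset.univ.filter fun w => ∃ v ∈ W, Relation.ReflTransGen G.dir w v

open Classical in
/-- The descendants of a set of vertices (every vertex is its own descendant). -/
noncomputable def de (G : MixedGraph V) (W : Finset V) : Finset V :=
  Finset.univ.filter fun w => ∃ v ∈ W, Relation.ReflTransGen G.dir v w

open Classical in
/-- The union of the districts of the vertices in a set. -/
noncomputable def dis (G : MixedGraph V) (W : Finset V) : Finset V :=
  Finset.univ.filter fun w => ∃ v ∈ W, Relation.ReflTransGen G.bidir w v

/-- The induced subgraph on `W`: only the edges with both endpoints in `W` are kept. The type of
vertices stays `V`; the vertices outside `W` are isolated, and the parents, descendants and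
districts of vertices in `W` are those in the induced subgraph. -/
def induce (G : MixedGraph V) (W : Finset V) : MixedGraph V where
  dir a b := a ∈ W ∧ b ∈ W ∧ G.dir a b
  bidir a b := a ∈ W ∧ b ∈ W ∧ G.bidir a b
  dir_irrefl a h := G.dir_irrefl a h.2.2
  bidir_irrefl a h := G.bidir_irrefl a h.2.2
  bidir_symm a b h := ⟨h.2.1, h.1, G.bidir_symm a b h.2.2⟩

/-- No directed cycles. -/
def IsAcyclic (G : MixedGraph V) : Prop :=
  ∀ v, ¬ Relation.TransGen G.dir v v

/-- The path `p` (the list of its distinct vertices) is m-connecting `a` and `b` given `C`: every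
nonendpoint that is a collider on `p` is in `an(C)`, every other nonendpoint is outside `C`.
In a graph with at most one edge between any two vertices, a path is determined by its vertices. -/
def IsMConnecting (G : MixedGraph V) (C : Finset V) (a b : V) (p : List V) : Prop :=
  p.head? = some a ∧ p.getLast? = some b ∧ p.Nodup ∧ p.IsChain G.Adj ∧
    ∀ u w v, [u, w, v] <:+: p →
      ((G.Into u w ∧ G.Into v w) → w ∈ G.an C) ∧ (¬ (G.Into u w ∧ G.Into v w) → w ∉ C)

/-- `A` and `B` are m-separated by `C`. -/
def MSep (G : MixedGraph V) (A B C : Finset V) : Prop :=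
  ∀ a ∈ A, ∀ b ∈ B, ¬ ∃ p : List V, G.IsMConnecting C a b p

/-- Maximal ancestral graphs: acyclic, maximal and ancestral. (The first and last conditions leave
at most one edge between any two vertices.) -/
def IsMAG (G : MixedGraph V) : Prop :=
  G.IsAcyclic ∧
  (∀ a b, a ≠ b → ¬ G.Adj a b → ∃ C : Finset V, a ∉ C ∧ b ∉ C ∧ G.MSep {a} {b} C) ∧
  (∀ v, Disjoint (G.sib {v}) (G.an {v}))

/-- The order on the vertices is topological: ancestors come first. -/
def IsTopologicallyOrdered [LE V] (G : MixedGraph V) : Prop :=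
  ∀ v w, w ∈ G.an {v} → w ≤ v

/-- The Markov blanket `mb(v, A)` of `v` with respect to `A`. -/
noncomputable def mb (G : MixedGraph V) (v : V) (A : Finset V) : Finset V :=
  ((G.induce A).pa ((G.induce A).dis {v}) ∪ (G.induce A).dis {v}) \ {v}

/-- The barren subset of `W`. -/
noncomputable def barren (G : MixedGraph V) (W : Finset V) : Finset V :=
  W.filter fun w => G.de {w} ∩ W = {w}

/-- Heads: nonempty barren sets, contained in a single district of the subgraph induced by their
ancestors. -/
def IsHead (G : MixedGraph V) (H : Finset V) : Prop :=
  H.Nonempty ∧ G.barren H = H ∧ ∃ h ∈ H, H ⊆ (G.induce (G.an H)).dis {h}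

/-- The tail of a head. -/
noncomputable def tail (G : MixedGraph V) (H : Finset V) : Finset V :=
  ((G.induce (G.an H)).dis H \ H) ∪ G.pa ((G.induce (G.an H)).dis H)

/-- The parametrizing sets: `H ∪ A` with `H` a head and `A` a subset of its tail; the empty set is
parametrizing as well. -/
def IsParametrizing (G : MixedGraph V) (S : Finset V) : Prop :=
  S = ∅ ∨ ∃ H, G.IsHead H ∧ ∃ A, A ⊆ G.tail H ∧ S = H ∪ A

/-- `H →^K H'` for heads `H`, `H'` and the vertex `i` (the maximal vertex of `H`): `K` is a
nonempty subset of `H \ {i}`, and `H'` is the barren subset of the district of `i` in the subgraph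
induced by `an(H) \ K`. -/
def Marginalizes (G : MixedGraph V) (i : V) (H K H' : Finset V) : Prop :=
  G.IsHead H ∧ G.IsHead H' ∧ K.Nonempty ∧ K ⊆ H \ {i} ∧
    (G.induce (G.an H \ K)).barren ((G.induce (G.an H \ K)).dis {i}) = H'

open Classical in
/-- The heads with maximal vertex `i`, except `{i}`. -/
noncomputable def headsBelow [LE V] (G : MixedGraph V) (i : V) : Finset (Finset V) :=
  Finset.univ.filter fun H => G.IsHead H ∧ IsGreatest (H : Set V) i ∧ H ≠ {i}

open Classical in
/-- The pairs `(K, H')` with `H →^K H'`. -/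
noncomputable def marginalizations (G : MixedGraph V) (i : V) (H : Finset V) :
    Finset (Finset V × Finset V) :=
  Finset.univ.filter fun q => G.Marginalizes i H q.1 q.2

end Graphs

end MixedGraph

/-- An imset over `V`: an integer-valued function on the subsets of `V`. -/
abbrev Imset (V : Type*) := Finset V → ℤ

namespace Imset

section Imsets

variable {V : Type*} [DecidableEq V]

/-- The identifier `δ_A`. -/
def delta (A : Finset V) : Imset V := fun B => if B = A then 1 else 0

/-- The triples `⟨A, B | C⟩`: three pairwise disjoint sets. -/
def IsTriple (A B C : Finset V) : Prop :=
  Disjoint A B ∧ Disjoint A C ∧ Disjoint B C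

/-- The semi-elementary imset `u_⟨A, B | C⟩`. -/
def semiElementary (A B C : Finset V) : Imset V :=
  delta (A ∪ B ∪ C) - delta (A ∪ C) - delta (B ∪ C) + delta C

/-- Elementary imsets: `u_⟨a, b | C⟩` for two distinct vertices outside `C`. -/
def IsElementary (u : Imset V) : Prop :=
  ∃ (a b : V) (C : Finset V), IsTriple {a} {b} C ∧ u = semiElementary {a} {b} C

/-- Combinatorial imsets: combinations of elementary imsets with coefficients in `ℕ`. -/
def IsCombinatorial (u : Imset V) : Prop :=
  u ∈ AddSubmonoid.closure {v : Imset V | IsElementary v}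

/-- The model induced by `u`: the triples `⟨A, B | C⟩` for which some positive multiple of `u`
is the sum of `u_⟨A, B | C⟩` and a combinatorial imset. (As semi-elementary imsets are
combinatorial, there are such triples only if `u` is structural, that is, has a combinatorial
positive multiple.) -/
def model (u : Imset V) : Set (Finset V × Finset V × Finset V) :=
  {t | IsTriple t.1 t.2.1 t.2.2 ∧
    ∃ k : ℕ, 0 < k ∧ IsCombinatorial (k • u - semiElementary t.1 t.2.1 t.2.2)}

end Imsets

end Imset

namespace MixedGraph

section Models

variable {V : Type*} [Fintype V] [DecidableEq V]

/-- The model induced by `G`: the triples `⟨A, B | C⟩` with `A` and `B` m-separated by `C`. -/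
def model (G : MixedGraph V) : Set (Finset V × Finset V × Finset V) :=
  {t | Imset.IsTriple t.1 t.2.1 t.2.2 ∧ G.MSep t.1 t.2.1 t.2.2}

open Classical in
/-- The characteristic imset: the indicator of the parametrizing sets. -/
noncomputable def charImset (G : MixedGraph V) : Imset V :=
  fun S => if G.IsParametrizing S then 1 else 0

/-- The standard imset: the Moebius transform of `1 - c_G`. -/
noncomputable def standardImset (G : MixedGraph V) : Imset V :=
  fun B => ∑ A ∈ Finset.univ.filter (fun A => B ⊆ A), (-1) ^ (A \ B).card * (1 - G.charImset A)

end Models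

end MixedGraph

/-! The Moebius transform sends the indicator of the subsets of `A` to `delta A` (`mobius_below`),
so the formula for the standard imset amounts to an identity for `1 - c(S)` at each `S`, in which
only the maximal vertex `i` of `S` contributes. Let B(A) be the district of `i` in the subgraph on
`A` together with its parents (`block`). Then H ∪ T = B(an H), and H →^K H' gives H' ∪ T' = B(an H \
K). After adding the terms with K = ∅, which vanish, the i-th summand at `S` is 1 - [S ⊆ B([i])] +
Σ_{H,K} (-1)^|K| ([S ⊆ B(an H \ K)] - [S ⊆ B(an H) \ K]). Summed over K, the last bracket leaves [H
⊆ S ⊆ B(an H)], and these add up to c(S) (`charImset_eq_sum`). The other bracket is grouped by the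
head of the district of `i` in an H \ K. A signed count (`sum_sum_headAt_eq`) leaves only the head
belonging to [i], so these terms add up to [S ⊆ B([i])] and cancel the term in front.

For the inclusion of models, imsets are paired with S ↦ -rank(X_v : v ∈ S), where X comes from a
linear structural equation model over the graph. Semi-elementary imsets pair nonnegatively, with
value zero exactly if span(A ∪ C) ∩ span(B ∪ C) = span(C) (`pairing_negRank_eq_zero_iff`). Every
term of the formula pairs to zero by a local Markov property (`LinearModel.pairing_eq_zero`), so
every triple of the induced model is an independence in all linear models. On the other hand, an
m-connecting path from a to b given C yields a chain a = z_0, ..., z_m = b with interior points in C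
and consecutive points linked outside C. A shortest such chain carries a model over the field with
two elements in which X at z_i is e_{i-1} + e_i (with e_{-1} = e_m = 0). There X_a lies in span({b}
∪ C) but not in span(C) (`IsLinkChain.exists_model`), a contradiction. -/

set_option linter.unusedSectionVars false

/-! ### Ancestral sets, districts, heads and tails. -/

namespace MixedGraph

section Basics

variable {V : Type*} [Fintype V] [DecidableEq V] {G : MixedGraph V}

theorem mem_an {W : Finset V} {w : V} :
    w ∈ G.an W ↔ ∃ v ∈ W, Relation.ReflTransGen G.dir w v := by
  simp [an]

theorem mem_de {W : Finset V} {w : V} :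
    w ∈ G.de W ↔ ∃ v ∈ W, Relation.ReflTransGen G.dir v w := by
  simp [de]

theorem mem_pa {W : Finset V} {w : V} : w ∈ G.pa W ↔ ∃ v ∈ W, G.dir w v := by
  simp [pa]

theorem mem_sib {W : Finset V} {w : V} : w ∈ G.sib W ↔ ∃ v ∈ W, G.bidir w v := by
  simp [sib]

theorem mem_dis {W : Finset V} {w : V} :
    w ∈ G.dis W ↔ ∃ v ∈ W, Relation.ReflTransGen G.bidir w v := by
  simp [dis]

theorem mem_dis_singleton {v w : V} :
    w ∈ G.dis {v} ↔ Relation.ReflTransGen G.bidir w v := by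
  simp [dis]

theorem subset_an (W : Finset V) : W ⊆ G.an W := fun w hw =>
  mem_an.2 ⟨w, hw, .refl⟩

theorem mem_barren {W : Finset V} {w : V} :
    w ∈ G.barren W ↔ w ∈ W ∧ ∀ v ∈ W, Relation.ReflTransGen G.dir w v → v = w := by
  simp only [barren, Finset.mem_filter, Finset.ext_iff, Finset.mem_inter, mem_de,
    Finset.mem_singleton, exists_eq_left]
  refine and_congr_right fun hw => ⟨fun h v hv hwv => (h v).1 ⟨hwv, hv⟩, fun h v => ?_⟩
  exact ⟨fun hv => h v hv.2 hv.1, by rintro rfl; exact ⟨.refl, hw⟩⟩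

theorem barren_subset (W : Finset V) : G.barren W ⊆ W := fun _ hw => (mem_barren.1 hw).1

theorem eq_barren_iff {W H : Finset V} (hHW : H ⊆ W) (hWH : W ⊆ G.an H)
    (hH : G.barren H = H) (hac : ∀ a b, Relation.ReflTransGen G.dir a b →
      Relation.ReflTransGen G.dir b a → a = b) : G.barren W = H := by
  ext w
  constructor
  · intro hw
    obtain ⟨hwW, hw⟩ := mem_barren.1 hw
    obtain ⟨h, hh, hwh⟩ := mem_an.1 (hWH hwW)
    exact hw h (hHW hh) hwh ▸ hh
  · intro hw
    refine mem_barren.2 ⟨hHW hw, fun v hv hwv => ?_⟩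
    obtain ⟨h, hh, hvh⟩ := mem_an.1 (hWH hv)
    rw [← hH] at hw
    have := (mem_barren.1 hw).2 h hh (hwv.trans hvh)
    subst this
    exact hac _ _ hvh hwv

/-- A set of vertices that contains the parents of its elements. -/
def Ancestral (G : MixedGraph V) (A : Finset V) : Prop :=
  ∀ a b, b ∈ A → G.dir a b → a ∈ A

theorem Ancestral.mem_of_reflTransGen {A : Finset V} (hA : G.Ancestral A) {a b : V}
    (hb : b ∈ A) (h : Relation.ReflTransGen G.dir a b) : a ∈ A := by
  induction h using Relation.ReflTransGen.head_induction_on with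
  | refl => exact hb
  | head hac _ ih => exact hA _ _ ih hac

theorem Ancestral.an_subset {A W : Finset V} (hA : G.Ancestral A) (hW : W ⊆ A) :
    G.an W ⊆ A := fun _ hw => by
  obtain ⟨v, hv, h⟩ := mem_an.1 hw
  exact hA.mem_of_reflTransGen (hW hv) h

theorem ancestral_an (W : Finset V) : G.Ancestral (G.an W) := fun a b hb hab => by
  obtain ⟨v, hv, h⟩ := mem_an.1 hb
  exact mem_an.2 ⟨v, hv, .head hab h⟩

/-- An element of the barren set `H` has no proper descendant in `an(H)`, so its removal deprives no
remaining vertex of a parent. -/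
theorem ancestral_an_sdiff {H K : Finset V} (hH : G.barren H = H) (hK : K ⊆ H)
    (hac : ∀ a b, Relation.ReflTransGen G.dir a b → Relation.ReflTransGen G.dir b a → a = b) :
    G.Ancestral (G.an H \ K) := fun a b hb hab => by
  obtain ⟨hb, hbK⟩ := Finset.mem_sdiff.1 hb
  refine Finset.mem_sdiff.2 ⟨ancestral_an H a b hb hab, fun haK => hbK ?_⟩
  obtain ⟨v, hv, h⟩ := mem_an.1 hb
  have haH := hK haK
  rw [← hH] at haH
  have hva := (mem_barren.1 haH).2 v hv (.head hab h)
  subst hva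
  exact hac b v h (.single hab) ▸ haK

theorem Ancestral.induce_barren {A W : Finset V} (hA : G.Ancestral A) (hW : W ⊆ A) :
    (G.induce A).barren W = G.barren W := by
  ext w
  rw [mem_barren, mem_barren]
  refine and_congr_right fun hw => forall₂_congr fun v hv => ?_
  have : Relation.ReflTransGen (G.induce A).dir w v ↔ Relation.ReflTransGen G.dir w v := by
    refine ⟨fun h => h.lift id fun _ _ h => h.2.2, fun h => ?_⟩
    have hvA := hW hv
    clear hv hw
    induction h using Relation.ReflTransGen.head_induction_on with
    | refl => exact .refl
    | head hac h ih => 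
      have := hA.mem_of_reflTransGen hvA h
      exact .head ⟨hA _ _ this hac, this, hac⟩ ih
  rw [this]

theorem reflTransGen_bidir_symm {a b : V} (h : Relation.ReflTransGen G.bidir a b) :
    Relation.ReflTransGen G.bidir b a := by
  induction h with
  | refl => exact .refl
  | tail _ hbc ih => exact .head (G.bidir_symm _ _ hbc) ih

/-- The district of `i` in the subgraph induced by `A`. -/
noncomputable def district (G : MixedGraph V) (A : Finset V) (i : V) : Finset V :=
  (G.induce A).dis {i}

/-- The district of `i` in the subgraph induced by `A`, together with its parents. -/
noncomputable def block (G : MixedGraph V) (A : Finset V) (i : V) : Finset V :=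
  G.district A i ∪ G.pa (G.district A i)

theorem mem_district {A : Finset V} {i w : V} :
    w ∈ G.district A i ↔ Relation.ReflTransGen (G.induce A).bidir w i :=
  mem_dis_singleton

theorem self_mem_district (A : Finset V) (i : V) : i ∈ G.district A i :=
  mem_district.2 .refl

theorem district_subset {A : Finset V} {i : V} (hi : i ∈ A) : G.district A i ⊆ A := fun w hw => by
  rcases (mem_district.1 hw).cases_head with rfl | ⟨c, hc, _⟩
  · exact hi
  · exact hc.1

theorem district_mono {A B : Finset V} (h : A ⊆ B) (i : V) :
    G.district A i ⊆ G.district B i := fun _ hw =>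
  mem_district.2 <| (mem_district.1 hw).lift id fun _ _ h' => ⟨h h'.1, h h'.2.1, h'.2.2⟩

theorem district_subset_district {A B : Finset V} {i : V} (h : G.district A i ⊆ B) :
    G.district A i ⊆ G.district B i := fun w hw => by
  replace hw := mem_district.1 hw
  induction hw using Relation.ReflTransGen.head_induction_on with
  | refl => exact self_mem_district _ _
  | head hac hci ih =>
    exact mem_district.2 (.head ⟨h (mem_district.2 (.head hac hci)), h (mem_district.2 hci),
      hac.2.2⟩ (mem_district.1 ih))

theorem mem_district_of_bidir {A : Finset V} {i v w : V} (hv : v ∈ G.district A i) (hi : i ∈ A)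
    (hw : w ∈ A) (hwv : G.bidir w v) : w ∈ G.district A i :=
  mem_district.2 (.head ⟨hw, district_subset hi hv, hwv⟩ (mem_district.1 hv))

theorem district_eq_of_subset {A B : Finset V} {i : V} (hAB : A ⊆ B) (h : G.district B i ⊆ A) :
    G.district A i = G.district B i :=
  (district_mono hAB i).antisymm (district_subset_district h)

/-- The district of `i` in `A` is `D`, the district of `i` in `B`, if and only if `A` contains
`D` but no sibling of `D` outside `D`. -/
theorem district_eq_iff {A B : Finset V} {i : V} (hi : i ∈ A) :
    G.district A i = G.district B i ↔
      G.district B i ⊆ A ∧ ∀ x ∈ A, x ∈ G.sib (G.district B i) → x ∈ G.district B i := by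
  constructor
  · intro h
    rw [← h]
    refine ⟨district_subset hi, fun x hx hs => ?_⟩
    obtain ⟨v, hv, hxv⟩ := mem_sib.1 hs
    exact mem_district_of_bidir hv hi hx hxv
  · rintro ⟨h1, h2⟩
    refine Finset.Subset.antisymm (fun w hw => ?_) (district_subset_district h1)
    replace hw := mem_district.1 hw
    induction hw using Relation.ReflTransGen.head_induction_on with
    | refl => exact self_mem_district _ _
    | head hac _ ih => exact h2 _ hac.1 (mem_sib.2 ⟨_, ih, hac.2.2⟩)

theorem IsHead.dis_eq_district {H : Finset V} (hH : G.IsHead H) {i : V} (hi : i ∈ H) :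
    (G.induce (G.an H)).dis H = G.district (G.an H) i := by
  obtain ⟨-, -, h, hh, hd⟩ := hH
  ext w
  rw [mem_dis, mem_district]
  constructor
  · rintro ⟨v, hv, hwv⟩
    exact (hwv.trans (mem_dis_singleton.1 (hd hv))).trans
      (reflTransGen_bidir_symm (mem_dis_singleton.1 (hd hi)))
  · exact fun h => ⟨i, hi, h⟩

theorem isHead_of_subset_district {H : Finset V} (hne : H.Nonempty) (hb : G.barren H = H) {i : V}
    (h : H ⊆ G.district (G.an H) i) : G.IsHead H := by
  obtain ⟨v, hv⟩ := hne
  exact ⟨⟨v, hv⟩, hb, v, hv, fun w hw => mem_dis_singleton.2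
    ((mem_district.1 (h hw)).trans (reflTransGen_bidir_symm (mem_district.1 (h hv))))⟩

theorem IsHead.subset_district {H : Finset V} (hH : G.IsHead H) {i : V} (hi : i ∈ H) :
    H ⊆ G.district (G.an H) i := fun w hw => by
  rw [← hH.dis_eq_district hi, mem_dis]
  exact ⟨w, hw, .refl⟩

theorem IsHead.union_tail {H : Finset V} (hH : G.IsHead H) {i : V} (hi : i ∈ H) :
    H ∪ G.tail H = G.block (G.an H) i := by
  have := hH.subset_district hi
  rw [tail, hH.dis_eq_district hi, block, ← Finset.union_assoc, Finset.union_sdiff_of_subset this]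

theorem Ancestral.block_subset {A : Finset V} (hA : G.Ancestral A) {i : V} (hi : i ∈ A) :
    G.block A i ⊆ A := by
  refine Finset.union_subset (district_subset hi) fun w hw => ?_
  obtain ⟨v, hv, hwv⟩ := mem_pa.1 hw
  exact hA _ _ (district_subset hi hv) hwv

theorem block_mono {A B : Finset V} (h : A ⊆ B) (i : V) : G.block A i ⊆ G.block B i := by
  refine Finset.union_subset_union (district_mono h i) fun w hw => ?_
  obtain ⟨v, hv, hwv⟩ := mem_pa.1 hw
  exact mem_pa.2 ⟨v, district_mono h i hv, hwv⟩

theorem self_mem_block (A : Finset V) (i : V) : i ∈ G.block A i :=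
  Finset.mem_union_left _ (self_mem_district A i)

theorem Ancestral.mb_eq {A : Finset V} (hA : G.Ancestral A) {i : V} (hi : i ∈ A) :
    G.mb i A = G.block A i \ {i} := by
  have : (G.induce A).pa (G.district A i) = G.pa (G.district A i) := by
    ext w
    rw [mem_pa, mem_pa]
    refine exists_congr fun v => and_congr_right fun hv => ⟨fun h => h.2.2, fun h => ?_⟩
    have := district_subset hi hv
    exact ⟨hA _ _ this h, this, h⟩
  change ((G.induce A).pa (G.district A i) ∪ G.district A i) \ {i} = _
  rw [this, Finset.union_comm, block]

theorem IsHead.barren_district {H : Finset V} (hH : G.IsHead H) {i : V} (hi : i ∈ H)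
    (hac : ∀ a b, Relation.ReflTransGen G.dir a b → Relation.ReflTransGen G.dir b a → a = b) :
    G.barren (G.district (G.an H) i) = H :=
  eq_barren_iff (hH.subset_district hi) (district_subset (subset_an H hi)) hH.2.1 hac

end Basics

/-! ### The head of a district under a topological order. -/

section Ordered

variable {n : ℕ} {G : MixedGraph (Fin n)}

theorem IsTopologicallyOrdered.le (hG : G.IsTopologicallyOrdered) {a b : Fin n}
    (h : Relation.ReflTransGen G.dir a b) : a ≤ b :=
  hG b a (mem_an.2 ⟨b, by simp, h⟩)

theorem IsTopologicallyOrdered.antisymm (hG : G.IsTopologicallyOrdered) (a b : Fin n)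
    (h : Relation.ReflTransGen G.dir a b) (h' : Relation.ReflTransGen G.dir b a) : a = b :=
  le_antisymm (hG.le h) (hG.le h')

theorem IsTopologicallyOrdered.lt (hG : G.IsTopologicallyOrdered) {a b : Fin n}
    (h : G.dir a b) : a < b :=
  lt_of_le_of_ne (hG.le (.single h)) fun e => G.dir_irrefl a (e ▸ h)

theorem IsTopologicallyOrdered.ancestral_Iic (hG : G.IsTopologicallyOrdered) (i : Fin n) :
    G.Ancestral (Finset.Iic i) := fun _ _ hb hab =>
  Finset.mem_Iic.2 ((hG.lt hab).le.trans (Finset.mem_Iic.1 hb))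

theorem IsTopologicallyOrdered.subset_an_barren (hG : G.IsTopologicallyOrdered)
    (W : Finset (Fin n)) : W ⊆ G.an (G.barren W) := fun w hw => by
  classical
  have hne : (W.filter fun v => Relation.ReflTransGen G.dir w v).Nonempty :=
    ⟨w, Finset.mem_filter.2 ⟨hw, .refl⟩⟩
  obtain ⟨v, hv, hmax⟩ := Finset.exists_max_image _ id hne
  obtain ⟨hvW, hwv⟩ := Finset.mem_filter.1 hv
  refine mem_an.2 ⟨v, mem_barren.2 ⟨hvW, fun x hx hvx => ?_⟩, hwv⟩
  exact le_antisymm (hmax x (Finset.mem_filter.2 ⟨hx, hwv.trans hvx⟩)) (hG.le hvx)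

theorem barren_barren {V : Type*} [Fintype V] [DecidableEq V] {G : MixedGraph V} (W : Finset V) :
    G.barren (G.barren W) = G.barren W := by
  refine (barren_subset _).antisymm fun w hw => mem_barren.2 ⟨hw, fun v hv h => ?_⟩
  exact (mem_barren.1 hw).2 v (barren_subset _ hv) h

/-- The barren subset of the district of `i` in the subgraph induced by `A`. -/
noncomputable def headAt {V : Type*} [Fintype V] [DecidableEq V] (G : MixedGraph V)
    (A : Finset V) (i : V) : Finset V :=
  G.barren (G.district A i)

variable {A : Finset (Fin n)} {i : Fin n}

theorem Ancestral.an_headAt_subset (hA : G.Ancestral A) (hi : i ∈ A) :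
    G.an (G.headAt A i) ⊆ A :=
  hA.an_subset ((barren_subset _).trans (district_subset hi))

/-- Every vertex of the district is an ancestor of its barren subset, so the district survives the
restriction to the ancestors of the head. This is why H' ∪ T' can be read off in `an(H) \ K`. -/
theorem Ancestral.district_an_headAt (hA : G.Ancestral A) (hi : i ∈ A)
    (hG : G.IsTopologicallyOrdered) :
    G.district (G.an (G.headAt A i)) i = G.district A i :=
  district_eq_of_subset (hA.an_headAt_subset hi) (hG.subset_an_barren _)

theorem Ancestral.block_an_headAt (hA : G.Ancestral A) (hi : i ∈ A)
    (hG : G.IsTopologicallyOrdered) :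
    G.block (G.an (G.headAt A i)) i = G.block A i := by
  rw [block, hA.district_an_headAt hi hG, block]

theorem Ancestral.isHead_headAt (hA : G.Ancestral A) (hi : i ∈ A)
    (hG : G.IsTopologicallyOrdered) : G.IsHead (G.headAt A i) := by
  have hne : (G.headAt A i).Nonempty := by
    obtain ⟨h, hh, _⟩ := mem_an.1 (hG.subset_an_barren _ (self_mem_district (G := G) A i))
    exact ⟨h, hh⟩
  refine isHead_of_subset_district hne (barren_barren _) (i := i) ?_
  rw [hA.district_an_headAt hi hG]
  exact barren_subset _

theorem self_mem_headAt (hG : G.IsTopologicallyOrdered) (hi : i ∈ A) (hAi : A ⊆ Finset.Iic i) :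
    i ∈ G.headAt A i :=
  mem_barren.2 ⟨self_mem_district _ _, fun _ hv h =>
    le_antisymm (Finset.mem_Iic.1 (hAi (district_subset hi hv))) (hG.le h)⟩

theorem isGreatest_headAt (hG : G.IsTopologicallyOrdered) (hi : i ∈ A)
    (hAi : A ⊆ Finset.Iic i) : IsGreatest (G.headAt A i : Set (Fin n)) i :=
  ⟨self_mem_headAt hG hi hAi, fun _ hv =>
    Finset.mem_Iic.1 (hAi (district_subset hi (barren_subset _ hv)))⟩

/-- A head containing `i` and its district determine each other. Conditions on heads thus become
conditions on districts, to which `district_eq_iff` applies. -/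
theorem Ancestral.headAt_eq_iff (hA : G.Ancestral A) (hi : i ∈ A)
    (hG : G.IsTopologicallyOrdered) {H : Finset (Fin n)} (hH : G.IsHead H) (hiH : i ∈ H) :
    G.headAt A i = H ↔ G.district A i = G.district (G.an H) i := by
  constructor
  · rintro rfl
    exact (hA.district_an_headAt hi hG).symm
  · intro h
    rw [headAt, h, hH.barren_district hiH hG.antisymm]

theorem an_subset_Iic (hG : G.IsTopologicallyOrdered) {H : Finset (Fin n)}
    (hH : IsGreatest (H : Set (Fin n)) i) : G.an H ⊆ Finset.Iic i :=
  (hG.ancestral_Iic i).an_subset fun _ hv => Finset.mem_Iic.2 (hH.2 hv)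

end Ordered

end MixedGraph

/-! ### Alternating sums over finite sets. -/

theorem Finset.sum_neg_one_pow_card_Icc {α : Type*} [DecidableEq α] (P Q : Finset α) :
    ∑ K ∈ Q.powerset, (if P ⊆ K then (-1 : ℤ) ^ K.card else 0) =
      if P = Q then (-1) ^ Q.card else 0 := by
  rw [← Finset.sum_filter, ← Finset.Icc_eq_filter_powerset]
  by_cases hPQ : P ⊆ Q
  · rw [Finset.Icc_eq_image_powerset hPQ, Finset.sum_image]
    · have : ∀ K ∈ (Q \ P).powerset, (-1 : ℤ) ^ (P ∪ K).card = (-1) ^ P.card * (-1) ^ K.card := by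
        intro K hK
        rw [Finset.card_union_of_disjoint, pow_add]
        exact Finset.disjoint_of_subset_right (Finset.mem_powerset.1 hK) Finset.disjoint_sdiff
      rw [Finset.sum_congr rfl this, ← Finset.mul_sum, Finset.sum_powerset_neg_one_pow_card]
      by_cases h : P = Q
      · simp [h]
      · have : Q \ P ≠ ∅ := fun h' => h (hPQ.antisymm (Finset.sdiff_eq_empty_iff_subset.1 h'))
        simp [h, this]
    · intro K hK K' hK' h
      have hK := Finset.mem_powerset.1 hK
      have hK' := Finset.mem_powerset.1 hK'
      ext x
      have := Finset.ext_iff.1 h x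
      have h1 := @hK x
      have h2 := @hK' x
      simp only [Finset.mem_union, Finset.mem_sdiff] at *
      tauto
  · have : P ≠ Q := fun h => hPQ h.subset
    rw [Finset.Icc_eq_empty (fun h => hPQ h)]
    simp [this]

theorem Finset.sum_neg_one_pow_card_disjoint {α : Type*} [DecidableEq α] (Q S : Finset α) :
    ∑ K ∈ Q.powerset, (if Disjoint K S then (-1 : ℤ) ^ K.card else 0) =
      if Q ⊆ S then 1 else 0 := by
  rw [← Finset.sum_filter]
  have : Q.powerset.filter (Disjoint · S) = (Q \ S).powerset := by
    ext K
    simp [Finset.subset_sdiff]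
  rw [this, Finset.sum_powerset_neg_one_pow_card]
  simp only [Finset.sdiff_eq_empty_iff_subset]

/-! ### The signed count of marginalizations to a given head. -/

namespace MixedGraph

variable {n : ℕ} {G : MixedGraph (Fin n)} {i : Fin n}

open Classical in
/-- The heads with maximal vertex `i`. -/
noncomputable def headsAt (G : MixedGraph (Fin n)) (i : Fin n) : Finset (Finset (Fin n)) :=
  Finset.univ.filter fun H => G.IsHead H ∧ IsGreatest (H : Set (Fin n)) i

theorem mem_headsAt {H : Finset (Fin n)} :
    H ∈ G.headsAt i ↔ G.IsHead H ∧ IsGreatest (H : Set (Fin n)) i := by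
  simp [headsAt]

section Marginal

variable {H K : Finset (Fin n)}

theorem ancestral_of_mem_headsAt (hG : G.IsTopologicallyOrdered) (hH : H ∈ G.headsAt i)
    (hK : K ⊆ H \ {i}) : G.Ancestral (G.an H \ K) :=
  ancestral_an_sdiff (mem_headsAt.1 hH).1.2.1 (hK.trans Finset.sdiff_subset) hG.antisymm

theorem mem_an_sdiff (hH : H ∈ G.headsAt i) (hK : K ⊆ H \ {i}) : i ∈ G.an H \ K :=
  Finset.mem_sdiff.2 ⟨subset_an H (mem_headsAt.1 hH).2.1, fun h => by simpa using hK h⟩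

theorem an_sdiff_subset_Iic (hG : G.IsTopologicallyOrdered) (hH : H ∈ G.headsAt i) :
    G.an H \ K ⊆ Finset.Iic i :=
  Finset.sdiff_subset.trans (an_subset_Iic hG (mem_headsAt.1 hH).2)

theorem headAt_mem_headsAt (hG : G.IsTopologicallyOrdered) {A : Finset (Fin n)}
    (hA : G.Ancestral A) (hi : i ∈ A) (hAi : A ⊆ Finset.Iic i) :
    G.headAt A i ∈ G.headsAt i :=
  mem_headsAt.2 ⟨hA.isHead_headAt hi hG, isGreatest_headAt hG hi hAi⟩

end Marginal

section Count

variable {H₀ : Finset (Fin n)}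

/-- The siblings of the district of a head in the subgraph of the vertices up to `i` that do not
belong to the district. -/
noncomputable def outerSib (G : MixedGraph (Fin n)) (i : Fin n) (H₀ : Finset (Fin n)) :
    Finset (Fin n) :=
  (G.sib (G.district (G.an H₀) i) ∩ Finset.Iic i) \ G.district (G.an H₀) i

open Classical in
/-- The elements of `outerSib` without proper ancestors there. -/
noncomputable def minOuterSib (G : MixedGraph (Fin n)) (i : Fin n) (H₀ : Finset (Fin n)) :
    Finset (Fin n) :=
  (G.outerSib i H₀).filter fun x => ∀ y ∈ G.outerSib i H₀, Relation.ReflTransGen G.dir y x → y = x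

theorem mem_outerSib {x : Fin n} : x ∈ G.outerSib i H₀ ↔
    x ∈ G.sib (G.district (G.an H₀) i) ∧ x ≤ i ∧ x ∉ G.district (G.an H₀) i := by
  simp [outerSib, and_assoc]

theorem mem_minOuterSib {x : Fin n} : x ∈ G.minOuterSib i H₀ ↔
    x ∈ G.outerSib i H₀ ∧ ∀ y ∈ G.outerSib i H₀, Relation.ReflTransGen G.dir y x → y = x := by
  simp [minOuterSib]

theorem not_mem_an_of_mem_outerSib (hi : i ∈ H₀) {x : Fin n} (hx : x ∈ G.outerSib i H₀) :
    x ∉ G.an H₀ := fun h => by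
  obtain ⟨hs, -, hd⟩ := mem_outerSib.1 hx
  obtain ⟨v, hv, hxv⟩ := mem_sib.1 hs
  exact hd (mem_district_of_bidir hv (subset_an _ hi) h hxv)

theorem minOuterSib_eq_empty_iff (hG : G.IsTopologicallyOrdered) (hH₀ : H₀ ∈ G.headsAt i) :
    G.minOuterSib i H₀ = ∅ ↔ G.headAt (Finset.Iic i) i = H₀ := by
  obtain ⟨hh, hgr⟩ := mem_headsAt.1 hH₀
  have hiI : i ∈ Finset.Iic i := Finset.mem_Iic.2 le_rfl
  rw [(hG.ancestral_Iic i).headAt_eq_iff hiI hG hh hgr.1, district_eq_iff hiI]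
  constructor
  · intro h
    refine ⟨(district_subset (subset_an _ hgr.1)).trans (an_subset_Iic hG hgr), fun x hx hxs => ?_⟩
    by_contra hxd
    have hne : (G.outerSib i H₀).Nonempty :=
      ⟨x, mem_outerSib.2 ⟨hxs, Finset.mem_Iic.1 hx, hxd⟩⟩
    obtain ⟨y, hy, hmin⟩ := Finset.exists_min_image _ id hne
    have : y ∈ G.minOuterSib i H₀ :=
      mem_minOuterSib.2 ⟨hy, fun z hz hzy => le_antisymm (hG.le hzy) (hmin z hz)⟩
    simp [h] at this
  · rintro ⟨-, h⟩
    refine Finset.eq_empty_of_forall_notMem fun x hx => ?_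
    obtain ⟨hs, hxi, hd⟩ := mem_outerSib.1 (mem_minOuterSib.1 hx).1
    exact hd (h x (Finset.mem_Iic.2 hxi) hs)

/-- The condition on `H` that leaves a nonzero sum over `K` of the signs of `H →^K H₀`. -/
def Bounds (G : MixedGraph (Fin n)) (i : Fin n) (H₀ H : Finset (Fin n)) : Prop :=
  G.district (G.an H₀) i ⊆ G.an H ∧
    G.outerSib i H₀ ∩ G.an H = H \ G.district (G.an H₀) i

-- With D the district of `H₀`, the admissible `K` exist only if D ⊆ an(H), and then form the
-- interval from `outerSib ∩ an(H)` to `H \ D`. The signs over an interval cancel unless its ends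
-- coincide, which is the condition `Bounds`.
open Classical in
theorem sum_headAt_eq (hG : G.IsTopologicallyOrdered) (hH₀ : H₀ ∈ G.headsAt i)
    {H : Finset (Fin n)} (hH : H ∈ G.headsAt i) :
    ∑ K ∈ (H \ {i}).powerset, (if G.headAt (G.an H \ K) i = H₀ then (-1 : ℤ) ^ K.card else 0) =
      if G.Bounds i H₀ H then (-1 : ℤ) ^ (H \ G.district (G.an H₀) i).card else 0 := by
  obtain ⟨hh, hgr⟩ := mem_headsAt.1 hH₀
  set D := G.district (G.an H₀) i with hD
  have key : ∀ K ∈ (H \ {i}).powerset, G.headAt (G.an H \ K) i = H₀ ↔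
      D ⊆ G.an H ∧ G.outerSib i H₀ ∩ G.an H ⊆ K ∧ K ⊆ H \ D := by
    intro K hK
    have hK := Finset.mem_powerset.1 hK
    have hi := mem_an_sdiff hH hK
    rw [(ancestral_of_mem_headsAt hG hH hK).headAt_eq_iff hi hG hh hgr.1,
      district_eq_iff hi, ← hD]
    constructor
    · rintro ⟨h1, h2⟩
      refine ⟨h1.trans Finset.sdiff_subset, fun x hx => ?_, fun x hx => ?_⟩
      · obtain ⟨hx, hxa⟩ := Finset.mem_inter.1 hx
        obtain ⟨hs, -, hd⟩ := mem_outerSib.1 hx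
        by_contra hxK
        exact hd (h2 x (Finset.mem_sdiff.2 ⟨hxa, hxK⟩) hs)
      · exact Finset.mem_sdiff.2 ⟨(Finset.mem_sdiff.1 (hK hx)).1, fun hxd =>
          (Finset.mem_sdiff.1 (h1 hxd)).2 hx⟩
    · rintro ⟨h1, h2, h3⟩
      refine ⟨fun x hx => Finset.mem_sdiff.2 ⟨h1 hx, fun hxK => (Finset.mem_sdiff.1 (h3 hxK)).2 hx⟩,
        fun x hx hxs => ?_⟩
      by_contra hxd
      have hxi := Finset.mem_Iic.1 (an_sdiff_subset_Iic hG hH hx)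
      obtain ⟨hxa, hxK⟩ := Finset.mem_sdiff.1 hx
      exact hxK (h2 (Finset.mem_inter.2 ⟨mem_outerSib.2 ⟨hxs, hxi, hxd⟩, hxa⟩))
  by_cases hDH : D ⊆ G.an H
  · have hiD : i ∈ D := self_mem_district _ _
    have hsub : (H \ D).powerset ⊆ (H \ {i}).powerset :=
      Finset.powerset_mono.2 (Finset.sdiff_subset_sdiff subset_rfl (by simpa using hiD))
    have h1 : ∑ K ∈ (H \ {i}).powerset,
        (if G.headAt (G.an H \ K) i = H₀ then (-1 : ℤ) ^ K.card else 0) =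
        ∑ K ∈ (H \ D).powerset, (if G.outerSib i H₀ ∩ G.an H ⊆ K then (-1 : ℤ) ^ K.card else 0) := by
      symm
      refine (Finset.sum_congr rfl fun K hK => ?_).trans (Finset.sum_subset hsub fun K hK hK' => ?_)
      · have := key K (hsub hK)
        have hK := Finset.mem_powerset.1 hK
        simp only [this, hDH, hK, and_true, true_and]
      · rw [if_neg]
        rw [key K hK]
        exact fun h => hK' (Finset.mem_powerset.2 h.2.2)
    rw [h1, Finset.sum_neg_one_pow_card_Icc]
    simp only [Bounds, ← hD, hDH, true_and]
  · rw [if_neg (fun h => hDH h.1)]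
    refine Finset.sum_eq_zero fun K hK => if_neg fun h => hDH ((key K hK).1 h).1

/-- An element of `H` inside the district is an ancestor of some element of `H₀`, which is an
ancestor of some element of `H`; as `H` is barren, all three coincide. So `H` is recovered from its
part outside the district. -/
theorem barren_sdiff_union (hG : G.IsTopologicallyOrdered) (hH₀ : H₀ ∈ G.headsAt i)
    {H : Finset (Fin n)} (hH : G.IsHead H) (hb : G.Bounds i H₀ H) :
    G.barren ((H \ G.district (G.an H₀) i) ∪ H₀) = H := by
  obtain ⟨hh, hgr⟩ := mem_headsAt.1 hH₀
  have hsub := hh.subset_district hgr.1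
  refine eq_barren_iff (fun h hhH => ?_) ?_ hH.2.1 hG.antisymm
  · by_cases hd : h ∈ G.district (G.an H₀) i
    · obtain ⟨h', hh', hhh'⟩ := mem_an.1 (district_subset (subset_an _ hgr.1) hd)
      obtain ⟨k, hk, hh'k⟩ := mem_an.1 (hb.1 (hsub hh'))
      rw [← hH.2.1] at hhH
      have := (mem_barren.1 hhH).2 k hk (hhh'.trans hh'k)
      subst this
      exact Finset.mem_union_right _ (hG.antisymm _ _ hhh' hh'k ▸ hh')
    · exact Finset.mem_union_left _ (Finset.mem_sdiff.2 ⟨hhH, hd⟩)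
  · exact Finset.union_subset (Finset.sdiff_subset.trans (subset_an _)) (hsub.trans hb.1)

section

variable {K : Finset (Fin n)} (hH₀ : H₀ ∈ G.headsAt i) (hK : K ⊆ G.minOuterSib i H₀)

include hH₀ hK

theorem subset_barren_union : K ⊆ G.barren (K ∪ H₀) := fun k hk => by
  obtain ⟨hh, hgr⟩ := mem_headsAt.1 hH₀
  have hkm := mem_minOuterSib.1 (hK hk)
  refine mem_barren.2 ⟨Finset.mem_union_left _ hk, fun v hv hkv => ?_⟩
  rcases Finset.mem_union.1 hv with hv | hv
  · exact ((mem_minOuterSib.1 (hK hv)).2 k hkm.1 hkv).symm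
  · exact absurd (mem_an.2 ⟨v, hv, hkv⟩) (not_mem_an_of_mem_outerSib hgr.1 hkm.1)

theorem barren_union_sdiff : G.barren (K ∪ H₀) \ G.district (G.an H₀) i = K := by
  obtain ⟨hh, hgr⟩ := mem_headsAt.1 hH₀
  ext x
  rw [Finset.mem_sdiff]
  constructor
  · rintro ⟨hx, hxd⟩
    exact (Finset.mem_union.1 (barren_subset _ hx)).resolve_right
      fun h => hxd (hh.subset_district hgr.1 h)
  · exact fun hx => ⟨subset_barren_union hH₀ hK hx,
      (mem_outerSib.1 (mem_minOuterSib.1 (hK hx)).1).2.2⟩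

/-- No outer sibling is an ancestor of `H₀`, so one that is an ancestor of `K ∪ H₀` is an ancestor
of `K`, and minimality of the elements of `K` puts it in `K`. -/
theorem bounds_barren_union (hG : G.IsTopologicallyOrdered) :
    G.Bounds i H₀ (G.barren (K ∪ H₀)) := by
  obtain ⟨hh, hgr⟩ := mem_headsAt.1 hH₀
  have hW := hG.subset_an_barren (K ∪ H₀)
  refine ⟨(district_subset (subset_an _ hgr.1)).trans ((ancestral_an _).an_subset
    (Finset.subset_union_right.trans hW)), ?_⟩
  rw [barren_union_sdiff hH₀ hK]
  ext x
  rw [Finset.mem_inter]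
  constructor
  · rintro ⟨hx, hxa⟩
    obtain ⟨v, hv, hxv⟩ := mem_an.1 hxa
    rcases Finset.mem_union.1 (barren_subset _ hv) with hv | hv
    · exact (mem_minOuterSib.1 (hK hv)).2 x hx hxv ▸ hv
    · exact absurd (mem_an.2 ⟨v, hv, hxv⟩) (not_mem_an_of_mem_outerSib hgr.1 hx)
  · exact fun hx => ⟨(mem_minOuterSib.1 (hK hx)).1, hW (Finset.mem_union_left _ hx)⟩

theorem barren_union_mem_headsAt (hG : G.IsTopologicallyOrdered) :
    G.barren (K ∪ H₀) ∈ G.headsAt i := by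
  obtain ⟨hh, hgr⟩ := mem_headsAt.1 hH₀
  have hW := hG.subset_an_barren (K ∪ H₀)
  have hle : ∀ v ∈ K ∪ H₀, v ≤ i := fun v hv => by
    rcases Finset.mem_union.1 hv with hv | hv
    · exact (mem_outerSib.1 (mem_minOuterSib.1 (hK hv)).1).2.1
    · exact hgr.2 hv
  have hi : i ∈ G.barren (K ∪ H₀) := mem_barren.2 ⟨Finset.mem_union_right _ hgr.1,
    fun v hv h => le_antisymm (hle v hv) (hG.le h)⟩
  refine mem_headsAt.2 ⟨isHead_of_subset_district ⟨i, hi⟩ (barren_barren _) (i := i) ?_, hi,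
    fun v hv => hle v (barren_subset _ hv)⟩
  -- The old district stays connected in the new ancestral set, and each element of `K` is a sibling
  -- of one of its vertices.
  have hD := district_subset_district (bounds_barren_union hH₀ hK hG).1
  refine (barren_subset _).trans (Finset.union_subset (fun k hk => ?_)
    ((hh.subset_district hgr.1).trans hD))
  obtain ⟨v, hv, hkv⟩ := mem_sib.1 (mem_outerSib.1 (mem_minOuterSib.1 (hK hk)).1).1
  exact mem_district_of_bidir (hD hv) (subset_an _ hi) (hW (Finset.mem_union_left _ hk)) hkv

end

open Classical in
/-- The signed number of the pairs `(H, K)` with `H →^K H₀` (the empty `K` included) is one for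
the head `H₀` of the district of `i` among the vertices up to `i`, and zero for other heads. -/
theorem sum_sum_headAt_eq (hG : G.IsTopologicallyOrdered) (hH₀ : H₀ ∈ G.headsAt i) :
    ∑ H ∈ G.headsAt i, ∑ K ∈ (H \ {i}).powerset,
      (if G.headAt (G.an H \ K) i = H₀ then (-1 : ℤ) ^ K.card else 0) =
      if G.headAt (Finset.Iic i) i = H₀ then 1 else 0 := by
  rw [Finset.sum_congr rfl fun H hH => sum_headAt_eq hG hH₀ hH, ← Finset.sum_filter]
  rw [← if_congr (minOuterSib_eq_empty_iff hG hH₀) rfl rfl,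
    ← Finset.sum_powerset_neg_one_pow_card]
  -- The heads satisfying `Bounds` correspond to the subsets of `minOuterSib`, so the double sum has
  -- become an alternating sum over a power set.
  refine Finset.sum_nbij' (fun H => H \ G.district (G.an H₀) i) (fun K => G.barren (K ∪ H₀))
    ?_ ?_ ?_ ?_ ?_
  · intro H hH
    obtain ⟨hH, hb⟩ := Finset.mem_filter.1 hH
    have hH := (mem_headsAt.1 hH).1
    refine Finset.mem_powerset.2 fun x hx => ?_
    have hxH := (Finset.mem_sdiff.1 hx).1
    rw [← hb.2] at hx
    refine mem_minOuterSib.2 ⟨(Finset.mem_inter.1 hx).1, fun y hy hyx => ?_⟩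
    have : y ∈ H \ G.district (G.an H₀) i := by
      rw [← hb.2]
      exact Finset.mem_inter.2 ⟨hy, mem_an.2 ⟨x, hxH, hyx⟩⟩
    have := (Finset.mem_sdiff.1 this).1
    rw [← hH.2.1] at this
    exact ((mem_barren.1 this).2 x hxH hyx).symm
  · intro K hK
    have hK := Finset.mem_powerset.1 hK
    exact Finset.mem_filter.2 ⟨barren_union_mem_headsAt hH₀ hK hG, bounds_barren_union hH₀ hK hG⟩
  · intro H hH
    obtain ⟨hH, hb⟩ := Finset.mem_filter.1 hH
    exact barren_sdiff_union hG hH₀ (mem_headsAt.1 hH).1 hb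
  · intro K hK
    exact barren_union_sdiff hH₀ (Finset.mem_powerset.1 hK)
  · intro H hH
    rfl

end Count

end MixedGraph

/-! ### The Moebius transform of indicators. -/

namespace Imset

variable {V : Type*} [Fintype V] [DecidableEq V]

/-- The superset Moebius transform. -/
def mobius : Imset V →+ Imset V where
  toFun g B := ∑ A ∈ Finset.univ.filter (fun A => B ⊆ A), (-1) ^ (A \ B).card * g A
  map_zero' := by ext; simp
  map_add' f g := by ext; simp [mul_add, Finset.sum_add_distrib]

theorem mobius_apply (g : Imset V) (B : Finset V) :
    mobius g B = ∑ A ∈ Finset.univ.filter (fun A => B ⊆ A), (-1) ^ (A \ B).card * g A := rfl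

/-- The indicator of the subsets of `A`. -/
def below (A : Finset V) : Imset V := fun S => if S ⊆ A then 1 else 0

theorem mobius_below (A : Finset V) : mobius (below A) = delta A := by
  ext B
  rw [mobius_apply, Finset.sum_filter]
  have h : ∀ S : Finset V, (if B ⊆ S then (-1 : ℤ) ^ (S \ B).card * below A S else 0) =
      if S ∈ A.powerset then (-1) ^ B.card * (if B ⊆ S then (-1) ^ S.card else 0) else 0 := by
    intro S
    simp only [below, Finset.mem_powerset]
    by_cases hB : B ⊆ S <;> by_cases hS : S ⊆ A <;> simp only [hB, hS, if_true, if_false, mul_zero,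
      mul_one]
    -- For B ⊆ S the numbers |S \ B| and |B| + |S| have the same parity.
    rw [← pow_add, ← Finset.card_sdiff_add_card_eq_card hB, add_comm, add_assoc, pow_add,
      ← two_mul, pow_mul]
    simp
  rw [Finset.sum_congr rfl fun S _ => h S, Finset.sum_ite_mem, Finset.univ_inter,
    ← Finset.mul_sum, Finset.sum_neg_one_pow_card_Icc, delta]
  by_cases hBA : B = A
  · subst hBA
    simp [← pow_add, ← two_mul]
  · simp [hBA]

/-- The combination of indicators whose Moebius transform is the semi-elementary imset. -/
def semiBelow (A B C : Finset V) : Imset V :=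
  below (A ∪ B ∪ C) - below (A ∪ C) - below (B ∪ C) + below C

theorem mobius_semiBelow (A B C : Finset V) :
    mobius (semiBelow A B C) = semiElementary A B C := by
  simp [semiBelow, semiElementary, mobius_below]

theorem semiBelow_of_notMem {i : V} {B C S : Finset V} (hS : i ∉ S) :
    semiBelow {i} B C S = 0 := by
  have h : ∀ T : Finset V, S ⊆ {i} ∪ T ↔ S ⊆ T := fun T => by
    refine ⟨fun h x hx => ?_, fun h => h.trans Finset.subset_union_right⟩
    rcases Finset.mem_union.1 (h hx) with h' | h'
    · exact absurd (Finset.mem_singleton.1 h' ▸ hx) hS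
    · exact h'
  simp only [semiBelow, below, Pi.add_apply, Pi.sub_apply, h, Finset.union_assoc]
  ring

theorem semiBelow_of_mem {i : V} {B C S : Finset V} (hS : i ∈ S) (hB : i ∉ B) (hC : i ∉ C) :
    semiBelow {i} B C S = below ({i} ∪ B ∪ C) S - below ({i} ∪ C) S := by
  have h1 : ¬ S ⊆ B ∪ C := fun h => by simpa [hB, hC] using h hS
  have h2 : ¬ S ⊆ C := fun h => hC (h hS)
  simp only [semiBelow, below, Pi.add_apply, Pi.sub_apply, if_neg h1, if_neg h2]
  ring

end Imset

/-! ### The decomposition of the standard imset. -/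

namespace MixedGraph

open Imset

variable {n : ℕ} {G : MixedGraph (Fin n)} {i : Fin n} {H K H' : Finset (Fin n)}

theorem standardImset_eq_mobius : G.standardImset = mobius (1 - G.charImset) := rfl

theorem mb_Iic_eq (hG : G.IsTopologicallyOrdered) (i : Fin n) :
    G.mb i (Finset.Iic i) = G.block (Finset.Iic i) i \ {i} :=
  (hG.ancestral_Iic i).mb_eq (Finset.mem_Iic.2 le_rfl)

theorem block_Iic_subset (hG : G.IsTopologicallyOrdered) (i : Fin n) :
    G.block (Finset.Iic i) i ⊆ Finset.Iic i :=
  (hG.ancestral_Iic i).block_subset (Finset.mem_Iic.2 le_rfl)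

theorem singleton_union_mb (hG : G.IsTopologicallyOrdered) (i : Fin n) :
    {i} ∪ G.mb i (Finset.Iic i) = G.block (Finset.Iic i) i := by
  rw [mb_Iic_eq hG, Finset.union_sdiff_of_subset (by simpa using self_mem_block _ _)]

theorem singleton_union_sdiff_mb (hG : G.IsTopologicallyOrdered) (i : Fin n) :
    {i} ∪ Finset.Iio i \ G.mb i (Finset.Iic i) ∪ G.mb i (Finset.Iic i) = Finset.Iic i := by
  have h := block_Iic_subset hG i
  rw [mb_Iic_eq hG]
  ext x
  have := @h x
  simp only [Finset.mem_union, Finset.mem_singleton, Finset.mem_sdiff, Finset.mem_Iio,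
    Finset.mem_Iic] at *
  rcases lt_trichotomy x i with hx | hx | hx
  · simp [hx, hx.le, hx.ne, em']
  · simp [hx]
  · simp only [hx.ne', hx.not_ge, hx.not_gt, imp_false] at *
    simp [this]

theorem isTriple_mb (hG : G.IsTopologicallyOrdered) (i : Fin n) :
    IsTriple {i} (Finset.Iio i \ G.mb i (Finset.Iic i)) (G.mb i (Finset.Iic i)) := by
  refine ⟨by simp, ?_, Finset.sdiff_disjoint⟩
  rw [mb_Iic_eq hG]
  exact Finset.disjoint_sdiff

/-- The block of `H'` when `H →^K H'`. -/
theorem union_tail_headAt (hG : G.IsTopologicallyOrdered) (hH : H ∈ G.headsAt i)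
    (hK : K ⊆ H \ {i}) :
    G.headAt (G.an H \ K) i ∪ G.tail (G.headAt (G.an H \ K) i) = G.block (G.an H \ K) i := by
  have hA := ancestral_of_mem_headsAt hG hH hK
  have hi := mem_an_sdiff hH hK
  rw [(hA.isHead_headAt hi hG).union_tail (self_mem_headAt hG hi (an_sdiff_subset_Iic hG hH)),
    hA.block_an_headAt hi hG]

theorem union_tail_of_mem_headsAt (hH : H ∈ G.headsAt i) :
    H ∪ G.tail H = G.block (G.an H) i :=
  (mem_headsAt.1 hH).1.union_tail (mem_headsAt.1 hH).2.1

theorem block_sdiff_subset (hG : G.IsTopologicallyOrdered) (hH : H ∈ G.headsAt i)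
    (hK : K ⊆ H \ {i}) : G.block (G.an H \ K) i ⊆ G.block (G.an H) i \ K := by
  have hA := ancestral_of_mem_headsAt hG hH hK
  have hi := mem_an_sdiff hH hK
  exact Finset.subset_sdiff.2 ⟨block_mono Finset.sdiff_subset i,
    Finset.disjoint_of_subset_left (hA.block_subset hi) Finset.sdiff_disjoint⟩

theorem isTriple_sdiff {A B : Finset (Fin n)} (hi : i ∈ B) :
    IsTriple {i} (A \ (B ∪ K)) (B \ {i}) := by
  refine ⟨by simp [hi], Finset.disjoint_sdiff, ?_⟩
  exact Finset.disjoint_of_subset_right (Finset.sdiff_subset.trans Finset.subset_union_left)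
    Finset.sdiff_disjoint

/-- The smaller block lies in the larger one and avoids `K`, so the three sets of the triple
together make up the larger block without `K`. -/
theorem semiBelow_block (hG : G.IsTopologicallyOrdered) (hH : H ∈ G.headsAt i)
    (hK : K ⊆ H \ {i}) {S : Finset (Fin n)} (hi : i ∈ S) :
    semiBelow {i} (G.block (G.an H) i \ (G.block (G.an H \ K) i ∪ K))
      (G.block (G.an H \ K) i \ {i}) S =
      below (G.block (G.an H) i \ K) S - below (G.block (G.an H \ K) i) S := by
  have hsub := block_sdiff_subset hG hH hK
  have hself := self_mem_block (G := G) (G.an H \ K) i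
  rw [semiBelow_of_mem hi (by simp [hself]) (by simp)]
  have h2 : {i} ∪ G.block (G.an H \ K) i \ {i} = G.block (G.an H \ K) i :=
    Finset.union_sdiff_of_subset (by simpa using hself)
  rw [h2, Finset.union_assoc, Finset.union_left_comm, h2]
  congr 2
  ext x
  have := @hsub x
  simp only [Finset.mem_union, Finset.mem_sdiff] at *
  tauto

theorem marginalizes_iff (hG : G.IsTopologicallyOrdered) (hH : H ∈ G.headsAt i) :
    G.Marginalizes i H K H' ↔ K.Nonempty ∧ K ⊆ H \ {i} ∧ G.headAt (G.an H \ K) i = H' := by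
  have hb : K ⊆ H \ {i} → (G.induce (G.an H \ K)).barren ((G.induce (G.an H \ K)).dis {i}) =
      G.headAt (G.an H \ K) i := fun hK =>
    (ancestral_of_mem_headsAt hG hH hK).induce_barren (district_subset (mem_an_sdiff hH hK))
  constructor
  · rintro ⟨-, -, hne, hK, h⟩
    exact ⟨hne, hK, (hb hK).symm.trans h⟩
  · rintro ⟨hne, hK, rfl⟩
    exact ⟨(mem_headsAt.1 hH).1, (ancestral_of_mem_headsAt hG hH hK).isHead_headAt
      (mem_an_sdiff hH hK) hG, hne, hK, hb hK⟩

theorem sum_marginalizations (hG : G.IsTopologicallyOrdered) (hH : H ∈ G.headsAt i)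
    {M : Type*} [AddCommMonoid M] (f : Finset (Fin n) → Finset (Fin n) → M) :
    ∑ q ∈ G.marginalizations i H, f q.1 q.2 =
      ∑ K ∈ (H \ {i}).powerset.erase ∅, f K (G.headAt (G.an H \ K) i) := by
  refine Finset.sum_bij' (fun q _ => q.1) (fun K _ => (K, G.headAt (G.an H \ K) i)) ?_ ?_ ?_ ?_ ?_
  · rintro ⟨K, H'⟩ hq
    obtain ⟨h1, h2, h3⟩ := (marginalizes_iff hG hH).1 (by simpa [marginalizations] using hq)
    simpa [h1.ne_empty] using h2
  · intro K hK
    obtain ⟨h1, h2⟩ := Finset.mem_erase.1 hK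
    simpa [marginalizations] using (marginalizes_iff hG hH).2
      ⟨Finset.nonempty_iff_ne_empty.2 h1, Finset.mem_powerset.1 h2, rfl⟩
  · rintro ⟨K, H'⟩ hq
    obtain ⟨h1, h2, h3⟩ := (marginalizes_iff hG hH).1 (by simpa [marginalizations] using hq)
    simp [h3]
  · intro K hK
    rfl
  · rintro ⟨K, H'⟩ hq
    obtain ⟨h1, h2, h3⟩ := (marginalizes_iff hG hH).1 (by simpa [marginalizations] using hq)
    simp [h3]

theorem headsBelow_eq : G.headsBelow i = (G.headsAt i).erase {i} := by
  ext H
  simp [headsBelow, mem_headsAt, and_assoc, and_comm]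

/-- The sum over heads and marginalizations, in terms of the blocks. -/
theorem sum_headsBelow (hG : G.IsTopologicallyOrdered) {M : Type*} [AddCommGroup M]
    (f : Finset (Fin n) → Finset (Fin n) → Finset (Fin n) → M) :
    ∑ H ∈ G.headsBelow i, ∑ q ∈ G.marginalizations i H,
      (-1 : ℤ) ^ (q.1.card + 1) •
        f (H ∪ G.tail H) (q.2 ∪ G.tail q.2) q.1 =
    ∑ H ∈ G.headsAt i, ∑ K ∈ (H \ {i}).powerset.erase ∅, (-1 : ℤ) ^ (K.card + 1) •
        f (G.block (G.an H) i) (G.block (G.an H \ K) i) K := by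
  rw [headsBelow_eq]
  refine (Finset.sum_congr rfl fun H hH => ?_).trans (Finset.sum_subset
    (Finset.erase_subset _ _) fun H hH hne => ?_)
  · have hH := Finset.mem_of_mem_erase hH
    rw [sum_marginalizations hG hH fun K H' => (-1 : ℤ) ^ (K.card + 1) •
        f (H ∪ G.tail H) (H' ∪ G.tail H') K]
    refine Finset.sum_congr rfl fun K hK => ?_
    have hK := Finset.mem_powerset.1 (Finset.mem_of_mem_erase hK)
    rw [union_tail_headAt hG hH hK, union_tail_of_mem_headsAt hH]
  -- The head `{i}` admits no nonempty `K`, so restoring it adds nothing.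
  · have : H = {i} := by
      by_contra h
      exact hne (Finset.mem_erase.2 ⟨h, hH⟩)
    subst this
    simp

section Pointwise

variable {S : Finset (Fin n)}

theorem eq_barren_of_subset_block (hG : G.IsTopologicallyOrdered) (hH : G.IsHead H) (hi : i ∈ H)
    (h1 : H ⊆ S) (h2 : S ⊆ G.block (G.an H) i) : G.barren S = H :=
  eq_barren_iff h1 (h2.trans ((ancestral_an H).block_subset (subset_an H hi))) hH.2.1 hG.antisymm

-- A head `H` with H ⊆ S ⊆ H ∪ T must be the barren subset of `S`, so at most one summand is
-- nonzero.
open Classical in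
theorem charImset_eq_sum (hG : G.IsTopologicallyOrdered) (hi : IsGreatest (S : Set (Fin n)) i) :
    G.charImset S =
      ∑ H ∈ G.headsAt i, if H ⊆ S ∧ S ⊆ G.block (G.an H) i then (1 : ℤ) else 0 := by
  rw [charImset]
  have hbar : i ∈ G.barren S := mem_barren.2 ⟨hi.1, fun v hv h => le_antisymm (hi.2 hv) (hG.le h)⟩
  have hpar : G.IsParametrizing S ↔
      G.barren S ∈ G.headsAt i ∧ S ⊆ G.block (G.an (G.barren S)) i := by
    constructor
    · rintro (rfl | ⟨H, hH, A, hA, hS⟩)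
      · exact absurd hi.1 (by simp)
      · obtain ⟨h, hh⟩ := hH.1
        have h1 : H ⊆ S := hS ▸ Finset.subset_union_left
        have h2 : S ⊆ G.block (G.an H) h := by
          rw [← hH.union_tail hh, hS]
          exact Finset.union_subset_union_right hA
        have hb := eq_barren_of_subset_block hG hH hh h1 h2
        rw [hb] at hbar ⊢
        refine ⟨mem_headsAt.2 ⟨hH, hbar, fun v hv => hi.2 (h1 hv)⟩, ?_⟩
        rw [← hH.union_tail hbar, hH.union_tail hh]
        exact h2
    · rintro ⟨h1, h2⟩
      refine Or.inr ⟨_, (mem_headsAt.1 h1).1, S \ G.barren S, ?_, ?_⟩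
      · rw [← union_tail_of_mem_headsAt h1] at h2
        intro x hx
        obtain ⟨hx, hxb⟩ := Finset.mem_sdiff.1 hx
        exact (Finset.mem_union.1 (h2 hx)).resolve_left hxb
      · exact (Finset.union_sdiff_of_subset (barren_subset _)).symm
  by_cases hp : G.IsParametrizing S
  · rw [if_pos hp]
    rw [hpar] at hp
    rw [Finset.sum_eq_single_of_mem _ hp.1]
    · rw [if_pos ⟨barren_subset _, hp.2⟩]
    · intro H hH hne
      refine if_neg fun h => hne ?_
      exact (eq_barren_of_subset_block hG (mem_headsAt.1 hH).1 (mem_headsAt.1 hH).2.1 h.1 h.2).symm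
  · rw [if_neg hp, Finset.sum_eq_zero]
    intro H hH
    refine if_neg fun h => hp (hpar.2 ?_)
    rw [eq_barren_of_subset_block hG (mem_headsAt.1 hH).1 (mem_headsAt.1 hH).2.1 h.1 h.2]
    exact ⟨hH, h.2⟩

/-- The block of `an(H) \ K` depends only on the head of the district of `i` there. Grouping by this
head leaves the signed counts of `sum_sum_headAt_eq` as coefficients. -/
theorem sum_below_block (hG : G.IsTopologicallyOrdered) :
    ∑ H ∈ G.headsAt i, ∑ K ∈ (H \ {i}).powerset,
      (-1 : ℤ) ^ K.card * below (G.block (G.an H \ K) i) S =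
      below (G.block (Finset.Iic i) i) S := by
  classical
  have h1 : ∀ H ∈ G.headsAt i, ∀ K ∈ (H \ {i}).powerset,
      (-1 : ℤ) ^ K.card * below (G.block (G.an H \ K) i) S =
      ∑ H₀ ∈ G.headsAt i, below (G.block (G.an H₀) i) S *
        if G.headAt (G.an H \ K) i = H₀ then (-1 : ℤ) ^ K.card else 0 := by
    intro H hH K hK
    have hK := Finset.mem_powerset.1 hK
    have hA := ancestral_of_mem_headsAt hG hH hK
    have hiA := mem_an_sdiff hH hK
    rw [Finset.sum_eq_single_of_mem _
      (headAt_mem_headsAt hG hA hiA (an_sdiff_subset_Iic hG hH)), if_pos rfl,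
      hA.block_an_headAt hiA hG, mul_comm]
    intro H₀ _ hne
    rw [if_neg hne.symm, mul_zero]
  have hI := hG.ancestral_Iic i
  have hiI := Finset.mem_Iic.2 (le_refl i)
  calc _ = ∑ H₀ ∈ G.headsAt i, below (G.block (G.an H₀) i) S *
        ∑ H ∈ G.headsAt i, ∑ K ∈ (H \ {i}).powerset,
          if G.headAt (G.an H \ K) i = H₀ then (-1 : ℤ) ^ K.card else 0 := by
        rw [Finset.sum_congr rfl fun H hH => Finset.sum_congr rfl (h1 H hH)]
        simp_rw [Finset.mul_sum]
        symm
        rw [Finset.sum_comm]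
        refine Finset.sum_congr rfl fun H _ => ?_
        rw [Finset.sum_comm]
    _ = ∑ H₀ ∈ G.headsAt i, below (G.block (G.an H₀) i) S *
          if G.headAt (Finset.Iic i) i = H₀ then 1 else 0 :=
        Finset.sum_congr rfl fun H₀ hH₀ => by rw [sum_sum_headAt_eq hG hH₀]
    _ = _ := by
        rw [Finset.sum_eq_single_of_mem _ (headAt_mem_headsAt hG hI hiI subset_rfl), if_pos rfl,
          hI.block_an_headAt hiI hG, mul_one]
        intro H₀ _ hne
        rw [if_neg hne.symm, mul_zero]

/-- `S ⊆ B \ K` means that `S ⊆ B` and that `K` avoids `S`. The signs of the subsets `K` of `H \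
{i}` avoiding `S` cancel unless only the empty set does, that is, unless `H ⊆ S`. -/
theorem sum_below_sdiff (hi : i ∈ S) (B : Finset (Fin n)) :
    ∑ K ∈ (H \ {i}).powerset, (-1 : ℤ) ^ K.card * below (B \ K) S =
      if H ⊆ S ∧ S ⊆ B then 1 else 0 := by
  have h : ∀ K, (-1 : ℤ) ^ K.card * below (B \ K) S =
      (if S ⊆ B then 1 else 0) * if Disjoint K S then (-1) ^ K.card else 0 := by
    intro K
    simp only [below, Finset.subset_sdiff, disjoint_comm (a := S)]
    by_cases h1 : S ⊆ B <;> by_cases h2 : Disjoint K S <;> simp [h1, h2]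
  rw [Finset.sum_congr rfl fun K _ => h K, ← Finset.mul_sum, Finset.sum_neg_one_pow_card_disjoint]
  have : H \ {i} ⊆ S ↔ H ⊆ S := by
    refine ⟨fun h x hx => ?_, fun h => Finset.sdiff_subset.trans h⟩
    by_cases hxi : x = i
    · exact hxi ▸ hi
    · exact h (Finset.mem_sdiff.2 ⟨hx, by simpa using hxi⟩)
  simp only [this]
  by_cases h1 : S ⊆ B <;> by_cases h2 : H ⊆ S <;> simp [h1, h2]

theorem one_sub_charImset_eq (hG : G.IsTopologicallyOrdered)
    (hi : IsGreatest (S : Set (Fin n)) i) :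
    1 - G.charImset S =
      semiBelow {i} (Finset.Iio i \ G.mb i (Finset.Iic i)) (G.mb i (Finset.Iic i)) S +
      ∑ H ∈ G.headsAt i, ∑ K ∈ (H \ {i}).powerset.erase ∅, (-1 : ℤ) ^ (K.card + 1) •
        semiBelow {i} (G.block (G.an H) i \ (G.block (G.an H \ K) i ∪ K))
          (G.block (G.an H \ K) i \ {i}) S := by
  have hiS : i ∈ S := hi.1
  have hS : S ⊆ Finset.Iic i := fun v hv => Finset.mem_Iic.2 (hi.2 hv)
  have h1 : ∑ H ∈ G.headsAt i, ∑ K ∈ (H \ {i}).powerset.erase ∅, (-1 : ℤ) ^ (K.card + 1) •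
        semiBelow {i} (G.block (G.an H) i \ (G.block (G.an H \ K) i ∪ K))
          (G.block (G.an H \ K) i \ {i}) S =
      ∑ H ∈ G.headsAt i, ∑ K ∈ (H \ {i}).powerset,
        ((-1 : ℤ) ^ K.card * below (G.block (G.an H \ K) i) S -
          (-1 : ℤ) ^ K.card * below (G.block (G.an H) i \ K) S) := by
    refine Finset.sum_congr rfl fun H hH => ?_
    -- The term with `K = ∅` is zero, as both of its sets are the block of `an(H)`.
    rw [← Finset.sum_erase (s := (H \ {i}).powerset) (a := ∅)]
    · refine Finset.sum_congr rfl fun K hK => ?_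
      have hK := Finset.mem_powerset.1 (Finset.mem_of_mem_erase hK)
      rw [semiBelow_block hG hH hK hiS, smul_eq_mul]
      ring
    · simp
  rw [h1]
  simp_rw [Finset.sum_sub_distrib]
  rw [sum_below_block hG]
  simp_rw [sum_below_sdiff hiS]
  have ht := isTriple_mb hG i
  rw [charImset_eq_sum hG hi, semiBelow_of_mem hiS (Finset.disjoint_singleton_left.1 ht.1)
    (Finset.disjoint_singleton_left.1 ht.2.1), singleton_union_sdiff_mb hG, singleton_union_mb hG]
  have : below (Finset.Iic i) S = 1 := if_pos hS
  rw [this]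
  ring

end Pointwise

theorem standardImset_eq (hG : G.IsTopologicallyOrdered) :
    G.standardImset = ∑ i : Fin n,
      (semiElementary {i} (Finset.Iio i \ G.mb i (Finset.Iic i)) (G.mb i (Finset.Iic i)) +
        ∑ H ∈ G.headsAt i, ∑ K ∈ (H \ {i}).powerset.erase ∅, (-1 : ℤ) ^ (K.card + 1) •
          semiElementary {i} (G.block (G.an H) i \ (G.block (G.an H \ K) i ∪ K))
            (G.block (G.an H \ K) i \ {i})) := by
  simp_rw [standardImset_eq_mobius, ← mobius_semiBelow, ← map_zsmul, ← map_sum, ← map_add,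
    ← map_sum]
  congr 1
  ext S
  simp only [Pi.sub_apply, Pi.one_apply, Finset.sum_apply, Pi.add_apply, Pi.smul_apply]
  rcases S.eq_empty_or_nonempty with rfl | hne
  · have : G.charImset ∅ = 1 := if_pos (Or.inl rfl)
    simp [this, semiBelow_of_notMem]
  · obtain ⟨i, hiS, hmax⟩ := Finset.exists_max_image S id hne
    have hi : IsGreatest (S : Set (Fin n)) i := ⟨hiS, fun v hv => hmax v hv⟩
    rw [one_sub_charImset_eq hG hi, eq_comm]
    refine Finset.sum_eq_single_of_mem i (Finset.mem_univ _) fun j _ hji => ?_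
    have hz : ∀ B C : Finset (Fin n), i ∉ {j} ∪ B ∪ C → semiBelow {j} B C S = 0 := by
      intro B C h
      have h' : ∀ T : Finset (Fin n), T ⊆ {j} ∪ B ∪ C → below T S = 0 := fun T hT =>
        if_neg fun hS => h (hT (hS hiS))
      simp only [semiBelow, Pi.add_apply, Pi.sub_apply]
      rw [h' _ subset_rfl, h' _ (by rw [Finset.union_right_comm]; exact Finset.subset_union_left),
        h' _ (by rw [Finset.union_assoc]; exact Finset.subset_union_right),
        h' _ Finset.subset_union_right]
      simp
    -- For j < i all sets in the j-th summand lie in `Iic j`, and none contains `S`. For j > i the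
    -- vertex j is not in `S`, and the four indicators cancel in pairs.
    rcases lt_or_gt_of_ne hji with hlt | hgt
    · have hiI : i ∉ Finset.Iic j := by simpa using hlt
      rw [hz _ _ (by rw [singleton_union_sdiff_mb hG]; exact hiI), zero_add]
      refine Finset.sum_eq_zero fun H hH => Finset.sum_eq_zero fun K hK => ?_
      rw [hz, smul_zero]
      have hK := Finset.mem_powerset.1 (Finset.mem_of_mem_erase hK)
      have hbl : G.block (G.an H) j ⊆ Finset.Iic j :=
        ((ancestral_an H).block_subset (subset_an H (mem_headsAt.1 hH).2.1)).trans
          (an_subset_Iic hG (mem_headsAt.1 hH).2)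
      refine fun h => hiI (Finset.union_subset (Finset.union_subset ?_ ?_) ?_ h)
      · simp
      · exact Finset.sdiff_subset.trans hbl
      · exact Finset.sdiff_subset.trans
          (((block_sdiff_subset hG hH hK).trans Finset.sdiff_subset).trans hbl)
    · have hjS : j ∉ S := fun h => absurd (hi.2 h) (not_le.2 hgt)
      simp [semiBelow_of_notMem hjS]

end MixedGraph

/-! ### Pairing imsets with rank functions. -/

namespace Imset

variable {V : Type*} [Fintype V] [DecidableEq V]

/-- The pairing of set functions with imsets. -/
def pairing (f : Finset V → ℤ) : Imset V →+ ℤ where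
  toFun u := ∑ S, f S * u S
  map_zero' := by simp
  map_add' u v := by simp [mul_add, Finset.sum_add_distrib]

theorem pairing_apply (f : Finset V → ℤ) (u : Imset V) : pairing f u = ∑ S, f S * u S := rfl

theorem pairing_delta (f : Finset V → ℤ) (A : Finset V) : pairing f (delta A) = f A := by
  simp [pairing_apply, delta]

theorem pairing_semiElementary (f : Finset V → ℤ) (A B C : Finset V) :
    pairing f (semiElementary A B C) = f (A ∪ B ∪ C) - f (A ∪ C) - f (B ∪ C) + f C := by
  simp [semiElementary, pairing_delta]

end Imset

section Rank

variable {V K W : Type*} [Fintype V] [DecidableEq V] [Field K] [AddCommGroup W] [Module K W]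

/-- The span of the vectors with indices in `S`. -/
def spanOf (K : Type*) [Field K] {W : Type*} [AddCommGroup W] [Module K W] (X : V → W)
    (S : Finset V) : Submodule K W := Submodule.span K (X '' S)

variable (X : V → W) (A B C S T : Finset V)

theorem spanOf_union : spanOf K X (S ∪ T) = spanOf K X S ⊔ spanOf K X T := by
  rw [spanOf, Finset.coe_union, Set.image_union, Submodule.span_union, spanOf, spanOf]

variable {X S T} in
theorem spanOf_mono (h : S ⊆ T) : spanOf K X S ≤ spanOf K X T :=
  Submodule.span_mono (Set.image_mono h)

variable {X S} in
theorem mem_spanOf {v : V} (h : v ∈ S) : X v ∈ spanOf K X S :=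
  Submodule.subset_span ⟨v, h, rfl⟩

/-- The supermodular set function of a family of vectors. -/
noncomputable def negRank (K : Type*) [Field K] {W : Type*} [AddCommGroup W] [Module K W]
    (X : V → W) (S : Finset V) : ℤ := -(Module.finrank K (spanOf K X S) : ℤ)

theorem spanOf_le_inf : spanOf K X C ≤ spanOf K X (A ∪ C) ⊓ spanOf K X (B ∪ C) :=
  le_inf (spanOf_mono Finset.subset_union_right) (spanOf_mono Finset.subset_union_right)

variable [FiniteDimensional K W]

/-- This is the dimension formula for the sum and the intersection of two subspaces. -/
theorem pairing_negRank : Imset.pairing (negRank K X) (Imset.semiElementary A B C) =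
    Module.finrank K (spanOf K X (A ∪ C) ⊓ spanOf K X (B ∪ C) : Submodule K W) -
      Module.finrank K (spanOf K X C) := by
  have h := Submodule.finrank_sup_add_finrank_inf_eq (spanOf K X (A ∪ C)) (spanOf K X (B ∪ C))
  have h' : spanOf K X (A ∪ C) ⊔ spanOf K X (B ∪ C) = spanOf K X (A ∪ B ∪ C) := by
    rw [← spanOf_union, ← Finset.union_union_distrib_right]
  rw [h'] at h
  rw [Imset.pairing_semiElementary]
  simp only [negRank]
  linarith [(by exact_mod_cast h : (Module.finrank K (spanOf K X (A ∪ B ∪ C)) : ℤ) +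
    Module.finrank K (spanOf K X (A ∪ C) ⊓ spanOf K X (B ∪ C) : Submodule K W) =
    Module.finrank K (spanOf K X (A ∪ C)) + Module.finrank K (spanOf K X (B ∪ C)))]

theorem pairing_negRank_nonneg :
    0 ≤ Imset.pairing (negRank K X) (Imset.semiElementary A B C) := by
  rw [pairing_negRank, sub_nonneg]
  exact_mod_cast Submodule.finrank_mono (spanOf_le_inf X A B C)

theorem pairing_negRank_eq_zero_iff :
    Imset.pairing (negRank K X) (Imset.semiElementary A B C) = 0 ↔
      spanOf K X (A ∪ C) ⊓ spanOf K X (B ∪ C) ≤ spanOf K X C := by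
  rw [pairing_negRank, sub_eq_zero, Nat.cast_inj]
  constructor
  · intro h
    exact (Submodule.eq_of_le_of_finrank_eq (spanOf_le_inf X A B C) h.symm).ge
  · intro h
    rw [h.antisymm (spanOf_le_inf X A B C)]

theorem pairing_negRank_nonneg_of_isCombinatorial {u : Imset V} (hu : Imset.IsCombinatorial u) :
    0 ≤ Imset.pairing (negRank K X) u := by
  induction hu using AddSubmonoid.closure_induction with
  | mem u hu =>
    obtain ⟨a, b, C, -, rfl⟩ := hu
    exact pairing_negRank_nonneg X _ _ _
  | zero => simp
  | add u v _ _ hu hv =>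
    rw [map_add]
    exact add_nonneg hu hv

end Rank

/-! ### Linear structural equation models and their local Markov property. -/

namespace MixedGraph

/-- A linear structural equation model over `G`: every vertex carries a linear combination of the
vectors of its parents plus a noise vector, and noise vectors share coordinates only along
bidirected edges. -/
structure LinearModel {V : Type*} [Fintype V] (G : MixedGraph V) (K ι : Type*) [Field K] where
  noise : V → ι → K
  coef : V → V → K
  vec : V → ι → K
  vec_eq : ∀ v, vec v = noise v + ∑ u, coef u v • vec u
  dir_of_coef : ∀ u v, coef u v ≠ 0 → G.dir u v
  bidir_of_noise : ∀ u v k, noise u k ≠ 0 → noise v k ≠ 0 → u ≠ v → G.bidir u v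

namespace LinearModel

variable {V K ι : Type*} [Fintype V] [DecidableEq V] [Field K] {G : MixedGraph V}
  (M : G.LinearModel K ι) {A : Finset V} {i : V}

theorem noise_eq (v : V) : M.noise v = M.vec v - ∑ u, M.coef u v • M.vec u := by
  conv_rhs => rw [M.vec_eq v, add_sub_cancel_right]

theorem sum_coef_mem {p : Submodule K (ι → K)} {v : V} (h : ∀ u, G.dir u v → M.vec u ∈ p) :
    ∑ u, M.coef u v • M.vec u ∈ p := by
  refine p.sum_mem fun u _ => ?_
  by_cases hu : M.coef u v = 0
  · simp [hu]
  · exact p.smul_mem _ (h u (M.dir_of_coef u v hu))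

theorem vec_mem_noise (hwf : WellFounded G.dir) {A : Finset V} (hA : G.Ancestral A) :
    ∀ v ∈ A, M.vec v ∈ spanOf K M.noise A := by
  intro v
  induction v using hwf.induction with
  | _ v ih =>
    intro hv
    rw [M.vec_eq v]
    exact add_mem (mem_spanOf hv) (M.sum_coef_mem fun u hu => ih u hu (hA u v hv hu))

/-- Within `A`, the noise of the district D of `i` shares no coordinate with the noise outside D.
Projecting to the coordinates of D therefore turns a relation for the noise of `i` over `A \ {i}`
into one over D \ {i}, and each noise vector there is a combination of the vectors of a vertex of D
and its parents. -/
theorem vec_mem_of_mem (hwf : WellFounded G.dir) (hA : G.Ancestral A) (hi : i ∈ A)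
    (hch : ∀ v ∈ A, ¬ G.dir i v) (h : M.vec i ∈ spanOf K M.vec (A \ {i})) :
    M.vec i ∈ spanOf K M.vec (G.block A i \ {i}) := by
  classical
  set D := G.district A i with hD
  set p := spanOf K M.vec (G.block A i \ {i}) with hp
  -- As `i` has no child in `A`, the vectors of the other vertices involve only noise from `A \
  -- {i}`.
  have hA' : G.Ancestral (A \ {i}) := fun a b hb hab => by
    obtain ⟨hb, -⟩ := Finset.mem_sdiff.1 hb
    refine Finset.mem_sdiff.2 ⟨hA a b hb hab, fun ha => ?_⟩
    rw [Finset.mem_singleton] at ha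
    exact hch b hb (ha ▸ hab)
  have hDA : D ⊆ A := district_subset hi
  have hpar : ∀ v ∈ D, ∑ u, M.coef u v • M.vec u ∈ p := fun v hv =>
    M.sum_coef_mem fun u hu => mem_spanOf <| Finset.mem_sdiff.2
      ⟨Finset.mem_union_right _ (mem_pa.2 ⟨v, hv, hu⟩), fun h => by
        rw [Finset.mem_singleton] at h
        exact hch v (hDA hv) (h ▸ hu)⟩
  have hDi : i ∈ D := self_mem_district _ _
  suffices hn : M.noise i ∈ p by
    rw [M.vec_eq i]
    exact add_mem hn (hpar i hDi)
  have hN : M.noise i ∈ spanOf K M.noise (A \ {i}) := by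
    rw [M.noise_eq]
    have hle : spanOf K M.vec (A \ {i}) ≤ spanOf K M.noise (A \ {i}) := by
      refine Submodule.span_le.2 ?_
      rintro _ ⟨v, hv, rfl⟩
      exact M.vec_mem_noise hwf hA' v hv
    refine sub_mem (hle h) (M.sum_coef_mem fun u hu => M.vec_mem_noise hwf hA' u ?_)
    refine Finset.mem_sdiff.2 ⟨hA u i hi hu, fun h => ?_⟩
    rw [Finset.mem_singleton] at h
    exact G.dir_irrefl i (h ▸ hu)
  -- Multiplication by `mask` is the projection to the coordinates used by the noise of D.
  let mask : ι → K := fun k => if ∃ v ∈ D, M.noise v k ≠ 0 then 1 else 0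
  have hmaskD : ∀ v ∈ D, mask * M.noise v = M.noise v := by
    intro v hv
    ext k
    by_cases hk : M.noise v k = 0
    · simp [hk]
    · simp only [mask, Pi.mul_apply]
      rw [if_pos ⟨v, hv, hk⟩, one_mul]
  have hmask : ∀ v ∈ A, v ∉ D → mask * M.noise v = 0 := by
    intro v hvA hvD
    ext k
    simp only [mask, Pi.mul_apply, Pi.zero_apply, mul_eq_zero]
    by_contra! hk
    obtain ⟨hk1, hk2⟩ := hk
    obtain ⟨u, hu, huk⟩ : ∃ u ∈ D, M.noise u k ≠ 0 := by
      by_contra h'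
      exact hk1 (if_neg h')
    exact hvD (mem_district_of_bidir hu hi hvA
      (M.bidir_of_noise v u k hk2 huk fun h => hvD (h ▸ hu)))
  have hmap : (spanOf K M.noise (A \ {i})).map (LinearMap.mulLeft K mask) ≤ p := by
    rw [spanOf, Submodule.map_span, Submodule.span_le]
    rintro _ ⟨_, ⟨v, hv, rfl⟩, rfl⟩
    obtain ⟨hvA, hvi⟩ := Finset.mem_sdiff.1 hv
    rw [LinearMap.mulLeft_apply]
    by_cases hvD : v ∈ D
    · rw [hmaskD v hvD, M.noise_eq]
      exact sub_mem (mem_spanOf (Finset.mem_sdiff.2 ⟨Finset.mem_union_left _ hvD, hvi⟩))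
        (hpar v hvD)
    · rw [hmask v hvA hvD]
      exact zero_mem _
  rw [← hmaskD i hDi]
  exact hmap (Submodule.mem_map_of_mem hN)

/-- Modulo the span of the Markov blanket, an element of the intersection is c times the vector of
`i`. If c ≠ 0, that vector lies in the span of `A \ {i}`, hence already in the span of the blanket.
-/
theorem pairing_eq_zero [Finite ι] (hwf : WellFounded G.dir) (hA : G.Ancestral A) (hi : i ∈ A)
    (hch : ∀ v ∈ A, ¬ G.dir i v) {B : Finset V} (hB : B ⊆ A \ {i}) :
    Imset.pairing (negRank K M.vec)
      (Imset.semiElementary {i} B (G.block A i \ {i})) = 0 := by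
  rw [pairing_negRank_eq_zero_iff]
  rintro x ⟨hx1, hx2⟩
  rw [SetLike.mem_coe, spanOf_union] at hx1
  obtain ⟨y, hy, z, hz, rfl⟩ := Submodule.mem_sup.1 hx1
  refine add_mem ?_ hz
  simp only [spanOf, Finset.coe_singleton, Set.image_singleton] at hy
  obtain ⟨c, rfl⟩ := Submodule.mem_span_singleton.1 hy
  rcases eq_or_ne c 0 with rfl | hc
  · simp
  refine Submodule.smul_mem _ _ (M.vec_mem_of_mem hwf hA hi hch ?_)
  have hCA : G.block A i \ {i} ⊆ A \ {i} := Finset.sdiff_subset_sdiff (hA.block_subset hi) subset_rfl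
  have h := sub_mem (spanOf_mono (Finset.union_subset hB hCA) hx2) (spanOf_mono hCA hz)
  rwa [add_sub_cancel_right, Submodule.smul_mem_iff _ hc] at h

end LinearModel

variable {n : ℕ} {G : MixedGraph (Fin n)}

theorem IsTopologicallyOrdered.wellFounded (hG : G.IsTopologicallyOrdered) :
    WellFounded G.dir :=
  Subrelation.wf (fun h => hG.lt h) wellFounded_lt

/-- Each triple of the decomposition conditions on the Markov blanket of `i` in an ancestral set
with maximal vertex `i`, namely [i] or `an(H) \ K`. -/
theorem LinearModel.pairing_standardImset {K ι : Type*} [Field K] [Finite ι]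
    (M : G.LinearModel K ι) (hG : G.IsTopologicallyOrdered) :
    Imset.pairing (negRank K M.vec) G.standardImset = 0 := by
  have hwf := hG.wellFounded
  have hch : ∀ (i : Fin n) (A : Finset (Fin n)), A ⊆ Finset.Iic i → ∀ v ∈ A, ¬ G.dir i v :=
    fun i A hA v hv h => absurd (hG.lt h) (not_lt.2 (Finset.mem_Iic.1 (hA hv)))
  rw [standardImset_eq hG, map_sum]
  refine Finset.sum_eq_zero fun i _ => ?_
  rw [map_add, map_sum, mb_Iic_eq hG, M.pairing_eq_zero hwf (hG.ancestral_Iic i)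
    (Finset.mem_Iic.2 le_rfl) (hch i _ subset_rfl), zero_add]
  · refine Finset.sum_eq_zero fun H hH => ?_
    rw [map_sum]
    refine Finset.sum_eq_zero fun K hK => ?_
    have hK := Finset.mem_powerset.1 (Finset.mem_of_mem_erase hK)
    rw [map_zsmul, M.pairing_eq_zero hwf (ancestral_of_mem_headsAt hG hH hK) (mem_an_sdiff hH hK)
      (hch i _ (an_sdiff_subset_Iic hG hH)), smul_zero]
    have hbl := (ancestral_an (G := G) H).block_subset (subset_an H (mem_headsAt.1 hH).2.1)
    intro x hx
    have hself := self_mem_block (G := G) (G.an H \ K) i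
    simp only [Finset.mem_sdiff, Finset.mem_union, not_or, Finset.mem_singleton] at hx ⊢
    exact ⟨⟨hbl hx.1, hx.2.2⟩, fun h => hx.2.1 (h ▸ hself)⟩
  · intro x hx
    have := Finset.mem_Iio.1 (Finset.mem_sdiff.1 hx).1
    simp [this.le, this.ne]

/-- Conditional independences in the model induced by the standard imset hold in all linear
models. -/
theorem LinearModel.inf_le_of_mem_model {K ι : Type*} [Field K] [Finite ι]
    (M : G.LinearModel K ι) (hG : G.IsTopologicallyOrdered) {A B C : Finset (Fin n)}
    (h : (A, B, C) ∈ Imset.model G.standardImset) :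
    spanOf K M.vec (A ∪ C) ⊓ spanOf K M.vec (B ∪ C) ≤ spanOf K M.vec C := by
  obtain ⟨-, k, -, hk⟩ := h
  have h0 := pairing_negRank_nonneg_of_isCombinatorial (K := K) M.vec hk
  rw [map_sub, map_nsmul, M.pairing_standardImset hG, smul_zero, zero_sub] at h0
  rw [← pairing_negRank_eq_zero_iff]
  exact le_antisymm (by simpa using h0) (pairing_negRank_nonneg _ _ _ _)

end MixedGraph

/-! ### From m-connecting paths to chordless chains of links. -/

namespace MixedGraph

section Links

variable {V : Type*} [Fintype V] [DecidableEq V] {G : MixedGraph V} {C : Finset V} {a b : V}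

/-- There is a directed path from `u` to `z` on which no vertex except possibly `z` is in `C`. -/
def Desc (G : MixedGraph V) (C : Finset V) : V → V → Prop :=
  Relation.ReflTransGen fun x y => x ∉ C ∧ G.dir x y

/-- Two vertices are linked outside `C` if they end directed paths as in `Desc` from a common
vertex outside `C` or from two vertices that are joined by a bidirected edge. -/
def Linked (G : MixedGraph V) (C : Finset V) (z z' : V) : Prop :=
  ∃ u u', G.Desc C u z ∧ G.Desc C u' z' ∧ ((u = u' ∧ u ∉ C) ∨ G.bidir u u')

/-- A sequence of links with interior points in `C`. -/
def IsLinkChain (G : MixedGraph V) (C : Finset V) (a b : V) (m : ℕ) (z : ℕ → V) : Prop :=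
  z 0 = a ∧ z m = b ∧ (∀ i, 0 < i → i < m → z i ∈ C) ∧ ∀ k < m, G.Linked C (z k) (z (k + 1))

theorem Linked.extend {z v w : V} (h : G.Linked C z v) (hv : G.Desc C v w) : G.Linked C z w := by
  obtain ⟨u, u', h1, h2, h3⟩ := h
  exact ⟨u, u', h1, h2.trans hv, h3⟩

theorem Desc.linked {v z : V} (h : G.Desc C v z) (hv : v ∉ C) : G.Linked C z v :=
  ⟨v, v, h, .refl, .inl ⟨rfl, hv⟩⟩

theorem Desc.linked_of_bidir {v w z : V} (h : G.Desc C v z) (hvw : G.bidir v w) :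
    G.Linked C z w :=
  ⟨v, w, h, .refl, .inr hvw⟩

theorem exists_desc_of_mem_an {v : V} (hv : v ∈ G.an C) : ∃ z ∈ C, G.Desc C v z := by
  obtain ⟨c, hc, h⟩ := mem_an.1 hv
  clear * - h hc
  induction h using Relation.ReflTransGen.head_induction_on with
  | refl => exact ⟨c, hc, .refl⟩
  | @head v w hvw _ ih =>
    by_cases hv : v ∈ C
    · exact ⟨v, hv, .refl⟩
    · obtain ⟨z, hz, hwz⟩ := ih
      exact ⟨z, hz, .head ⟨hv, hvw⟩ hwz⟩

theorem IsMAG.not_into (hG : G.IsMAG) {v w : V} (h : G.dir w v) : ¬ G.Into v w := by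
  rintro (h' | h')
  · exact hG.1 v (.head h' (.single h))
  · exact Finset.disjoint_left.1 (hG.2.2 v)
      (mem_sib.2 ⟨v, by simp, G.bidir_symm _ _ h'⟩ : w ∈ G.sib {v})
      (mem_an.2 ⟨v, by simp, .single h⟩)

theorem notMem_of_not_into {x w : V} {l : List V} (hb : b ∉ C)
    (hlast : (x :: w :: l).getLast? = some b)
    (hC : ∀ u v y, [u, v, y] <:+: x :: w :: l →
      ((G.Into u v ∧ G.Into y v) → v ∈ G.an C) ∧ (¬ (G.Into u v ∧ G.Into y v) → v ∉ C))
    (h : ¬ G.Into x w) : w ∉ C := by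
  cases l with
  | nil =>
    obtain rfl : w = b := by simpa using hlast
    exact hb
  | cons y l => exact (hC x w y ⟨[], l, by simp⟩).2 fun h' => h h'.1

/-- A vertex is reached from `a` by links through `C`. -/
def Reached (G : MixedGraph V) (C : Finset V) (a z : V) : Prop :=
  Relation.ReflTransGen (fun x y => G.Linked C x y ∧ y ∈ C) a z

/-- Induction along the path: `z` is the last point of the chain so far, linked to the current
vertex `v`. An edge without arrowhead at `v` is travelled upwards, and then `v` descends to `z`, as
`hxv` records. At a collider, a descent from `v` to `C` supplies the next point. -/
theorem exists_linked_of_path (hG : G.IsMAG) (hb : b ∉ C) (l : List V) (x v z : V)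
    (hadj : (x :: v :: l).IsChain G.Adj) (hlast : (x :: v :: l).getLast? = some b)
    (hC : ∀ u w y, [u, w, y] <:+: x :: v :: l →
      ((G.Into u w ∧ G.Into y w) → w ∈ G.an C) ∧ (¬ (G.Into u w ∧ G.Into y w) → w ∉ C))
    (hz : G.Reached C a z) (hzv : G.Linked C z v) (hxv : ¬ G.Into x v → G.Desc C v z) :
    ∃ z', G.Reached C a z' ∧ G.Linked C z' b := by
  induction l generalizing x v z with
  | nil =>
    obtain rfl : v = b := by simpa using hlast
    exact ⟨z, hz, hzv⟩
  | cons w l ih =>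
    have hvw : G.Adj v w := by
      simp only [List.isChain_cons_cons] at hadj
      exact hadj.2.1
    have hC' : ∀ u w' y, [u, w', y] <:+: v :: w :: l →
        ((G.Into u w' ∧ G.Into y w') → w' ∈ G.an C) ∧ (¬ (G.Into u w' ∧ G.Into y w') → w' ∉ C) :=
      fun u w' y h => hC u w' y (h.trans (List.suffix_cons _ _).isInfix)
    have hlast' : (v :: w :: l).getLast? = some b := by simpa using hlast
    have hnext := fun z hz h1 h2 => ih v w z (by simpa using (List.isChain_cons_cons.1 hadj).2)
      hlast' hC' hz h1 h2
    obtain ⟨hcol, hncol⟩ := hC x v w ⟨[], l, by simp⟩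
    have hw : ¬ G.Into v w → w ∉ C := notMem_of_not_into (l := l) hb hlast' hC'
    -- Suppose the next edge has an arrowhead at `v`: a parent `w` of `v` descends to the same `z`,
    -- and a sibling is linked to `z` through the bidirected edge.
    have up : ∀ z, G.Reached C a z → G.Desc C v z → G.Into w v →
        ∃ z', G.Reached C a z' ∧ G.Linked C z' b := by
      intro z hz hvz hwv
      by_cases hdir : G.dir w v
      · have hwC := hw (hG.not_into hdir)
        have hwz : G.Desc C w z := .head ⟨hwC, hdir⟩ hvz
        exact hnext z hz (hwz.linked hwC) fun _ => hwz
      · have hbi : G.bidir v w := G.bidir_symm _ _ (hwv.resolve_left hdir)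
        exact hnext z hz (hvz.linked_of_bidir hbi) fun h => absurd (.inr hbi) h
    by_cases hc : G.Into x v ∧ G.Into w v
    · obtain ⟨z', hz', hvz'⟩ := exists_desc_of_mem_an (hcol hc)
      exact up z' (hz.tail ⟨hzv.extend hvz', hz'⟩) hvz' hc.2
    · have hvC := hncol hc
      by_cases hdir : G.dir v w
      · exact hnext z hz (hzv.extend (.single ⟨hvC, hdir⟩)) fun h => absurd (.inl hdir) h
      · have hwv : G.Into w v :=
          (hvw.resolve_left hdir).imp id (G.bidir_symm _ _)
        exact up z hz (hxv fun h => hc ⟨h, hwv⟩) hwv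

theorem Reached.exists_isLinkChain {z : V} (hz : G.Reached C a z) (h : G.Linked C z b) :
    ∃ m s, G.IsLinkChain C a b m s := by
  have key : ∃ (m : ℕ) (s : ℕ → V), s 0 = a ∧ s m = z ∧ (∀ i, 0 < i → i ≤ m → s i ∈ C) ∧
      ∀ k < m, G.Linked C (s k) (s (k + 1)) := by
    clear h
    induction hz with
    | refl => exact ⟨0, fun _ => a, rfl, rfl, by omega, by omega⟩
    | @tail y z _ h ih =>
      obtain ⟨m, s, h0, hm, hC, hl⟩ := ih
      refine ⟨m + 1, fun k => if k ≤ m then s k else z, by simp [h0], by simp, ?_, ?_⟩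
      · intro i hi him
        by_cases him' : i ≤ m
        · simpa [him'] using hC i hi him'
        · simpa [him'] using h.2
      · intro k hk
        rcases Nat.lt_succ_iff_lt_or_eq.1 hk with hk | rfl
        · simpa [hk.le, Nat.succ_le_of_lt hk] using hl k hk
        · simpa [hm] using h.1
  obtain ⟨m, s, h0, hm, hC, hl⟩ := key
  refine ⟨m + 1, fun k => if k ≤ m then s k else b, by simp [h0], by simp, ?_, ?_⟩
  · intro i hi him
    have : i ≤ m := by omega
    simpa [this] using hC i hi this
  · intro k hk
    rcases Nat.lt_succ_iff_lt_or_eq.1 hk with hk | rfl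
    · simpa [hk.le, Nat.succ_le_of_lt hk] using hl k hk
    · simpa [hm] using h

theorem IsMConnecting.exists_isLinkChain (hG : G.IsMAG) (ha : a ∉ C) (hb : b ∉ C) (hab : a ≠ b)
    {p : List V} (hp : G.IsMConnecting C a b p) : ∃ m s, G.IsLinkChain C a b m s := by
  obtain ⟨hhead, hlast, -, hadj, hC⟩ := hp
  match p, hhead, hlast, hadj, hC with
  | [x], hhead, hlast, _, _ =>
    simp only [List.head?_cons, Option.some.injEq, List.getLast?_singleton] at hhead hlast
    exact absurd (hhead.symm.trans hlast) hab
  | x :: v :: l, hhead, hlast, hadj, hC =>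
    obtain rfl : x = a := by simpa using hhead
    have key := fun z hz h1 h2 =>
      exists_linked_of_path (a := x) hG hb l x v z hadj hlast hC hz h1 h2
    suffices h : ∃ z', G.Reached C x z' ∧ G.Linked C z' b by
      obtain ⟨z, hz, h⟩ := h
      exact hz.exists_isLinkChain h
    have hv : ¬ G.Into x v → v ∉ C := notMem_of_not_into (l := l) hb hlast hC
    rcases (List.isChain_cons_cons.1 hadj).1 with h | h | h
    · exact key x .refl ⟨x, x, .refl, .single ⟨ha, h⟩, .inl ⟨rfl, ha⟩⟩ fun h' => absurd (.inl h) h'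
    · have hvC := hv (hG.not_into h)
      have hd : G.Desc C v x := .single ⟨hvC, h⟩
      exact key x .refl (hd.linked hvC) fun _ => hd
    · exact key x .refl (Desc.linked_of_bidir .refl h) fun h' => absurd (.inr h) h'

/-- A sequence of links is without chords: points at distance at least two are not linked. -/
def IsChordless (G : MixedGraph V) (C : Finset V) (m : ℕ) (z : ℕ → V) : Prop :=
  (∀ i j, i + 1 < j → j ≤ m → ¬ G.Linked C (z i) (z j)) ∧ ∀ i j, i < j → j ≤ m → z i ≠ z j

/-- In a shortest chain, a link between points at distance at least two would give a shortcut. A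
repeated point would give such a link, or identify `b` with `a` or with a point of `C`. -/
theorem exists_isChordless (hb : b ∉ C) (hab : a ≠ b)
    (h : ∃ m s, G.IsLinkChain C a b m s) :
    ∃ m s, G.IsLinkChain C a b m s ∧ G.IsChordless C m s := by
  classical
  obtain ⟨s, hs⟩ := Nat.find_spec h
  have hmin := fun m hm => Nat.find_min h (m := m) hm
  set m := Nat.find h
  obtain ⟨h0, hm, hC, hl⟩ := hs
  have hch : ∀ i j, i + 1 < j → j ≤ m → ¬ G.Linked C (s i) (s j) := by
    intro i j hij hj hlij
    refine hmin (m - (j - i - 1)) (by omega)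
      ⟨fun k => if k ≤ i then s k else s (k + (j - i - 1)), by simp [h0], ?_, ?_, ?_⟩
    · have h1 : ¬ m - (j - i - 1) ≤ i := by omega
      have h2 : m - (j - i - 1) + (j - i - 1) = m := by omega
      simp only [h1, if_false, h2, hm]
    · intro k hk hk'
      by_cases hki : k ≤ i
      · simpa [hki] using hC k hk (by omega)
      · simpa [hki] using hC (k + (j - i - 1)) (by omega) (by omega)
    · intro k hk
      rcases lt_trichotomy k i with hki | rfl | hki
      · simpa [hki.le, Nat.succ_le_of_lt hki] using hl k (by omega)
      · have : k + 1 + (j - k - 1) = j := by omega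
        simpa [this] using hlij
      · have h1 : ¬ k ≤ i := by omega
        have h2 : ¬ k + 1 ≤ i := by omega
        have h3 : k + 1 + (j - i - 1) = k + (j - i - 1) + 1 := by omega
        simp only [h1, h2, if_false, h3]
        exact hl _ (by omega)
  refine ⟨m, s, ⟨h0, hm, hC, hl⟩, hch, fun i j hij hj he => ?_⟩
  rcases hj.lt_or_eq with hj | rfl
  · exact hch i (j + 1) (by omega) hj (he ▸ hl j hj)
  · rcases Nat.eq_zero_or_pos i with rfl | hi
    · exact hab (h0.symm.trans (he.trans hm))
    · exact hb (hm ▸ he ▸ hC i hi hij)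

end Links

end MixedGraph

/-! ### A linear model over the field with two elements for a chordless chain. -/

namespace MixedGraph

section Model

variable {V : Type*} [Fintype V] [DecidableEq V] {G : MixedGraph V}

theorem exists_linearModel {K ι : Type*} [Field K] (hwf : WellFounded G.dir)
    (noise : V → ι → K) (coef : V → V → K) (hc : ∀ u v, coef u v ≠ 0 → G.dir u v)
    (hn : ∀ u v k, noise u k ≠ 0 → noise v k ≠ 0 → u ≠ v → G.bidir u v) :
    ∃ M : G.LinearModel K ι, M.noise = noise ∧ M.coef = coef := by
  classical
  let F : ∀ v, (∀ u, G.dir u v → ι → K) → ι → K := fun v x =>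
    noise v + ∑ u, if h : G.dir u v then coef u v • x u h else 0
  refine ⟨⟨noise, coef, hwf.fix F, fun v => ?_, hc, hn⟩, rfl, rfl⟩
  rw [hwf.fix_eq]
  refine congrArg (noise v + ·) (Finset.sum_congr rfl fun u _ => ?_)
  by_cases h : G.dir u v
  · rw [dif_pos h]
  · have : coef u v = 0 := by
      by_contra h'
      exact h (hc u v h')
    rw [dif_neg h, this, zero_smul]

variable {C : Finset V} {a b : V} {m : ℕ} {z : ℕ → V}

/-- The vertices with directed paths outside `C` to the point `z i`. -/
def Above (G : MixedGraph V) (C : Finset V) (m : ℕ) (z : ℕ → V) (i : ℕ) (v : V) : Prop :=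
  i ≤ m ∧ G.Desc C v (z i)

/-- The ends `u`, `u'` of the two directed paths to `z k` and `z (k + 1)`: a common vertex as low
as possible, or two vertices that are joined by a bidirected edge. -/
def IsTop (G : MixedGraph V) (C : Finset V) (m : ℕ) (z : ℕ → V) (k : ℕ) (u u' : V) : Prop :=
  G.Above C m z k u ∧ G.Above C m z (k + 1) u' ∧
    ((u = u' ∧ ∀ y, G.dir u y → ¬ (G.Above C m z k y ∧ G.Above C m z (k + 1) y)) ∨
      (G.bidir u u' ∧ ∀ w, ¬ (G.Above C m z k w ∧ G.Above C m z (k + 1) w)))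

theorem Above.eq_of_mem {i : ℕ} {v : V} (h : G.Above C m z i v) (hv : v ∈ C) : v = z i := by
  rcases h.2.cases_head with h | ⟨c, hc, -⟩
  · exact h
  · exact absurd hv hc.1

theorem Above.exists_dir {i : ℕ} {v : V} (h : G.Above C m z i v) (hv : v ≠ z i) :
    ∃ y, G.dir v y ∧ G.Above C m z i y ∧ v ∉ C := by
  rcases h.2.cases_head with h' | ⟨y, hy, hyz⟩
  · exact absurd h' hv
  · exact ⟨y, hy.2, ⟨h.1, hyz⟩, hy.1⟩

theorem Above.head {i : ℕ} {v y : V} (h : G.Above C m z i y) (hv : v ∉ C) (hvy : G.dir v y) :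
    G.Above C m z i v :=
  ⟨h.1, .head ⟨hv, hvy⟩ h.2⟩

/-- A vertex outside `C` above two points links them, so the points are consecutive. A vertex of `C`
above two points would equal both, but the points are distinct. -/
theorem IsChordless.above_above (hz : G.IsChordless C m z) {i j : ℕ} {v : V}
    (hi : G.Above C m z i v) (hj : G.Above C m z j v) (hij : i < j) : j = i + 1 ∧ v ∉ C := by
  have hv : v ∉ C := fun hv => hz.2 i j hij hj.1 ((hi.eq_of_mem hv).symm.trans (hj.eq_of_mem hv))
  refine ⟨?_, hv⟩
  by_contra h
  exact hz.1 i j (by omega) hj.1 ⟨v, v, hi.2, hj.2, .inl ⟨rfl, hv⟩⟩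

theorem IsChordless.not_above_of_bidir (hz : G.IsChordless C m z) {i j : ℕ} {u u' : V}
    (hi : G.Above C m z i u) (hj : G.Above C m z j u') (hu : G.bidir u u') (hij : i + 1 < j) :
    False :=
  hz.1 i j hij hj.1 ⟨u, u', hi.2, hj.2, .inr hu⟩

theorem IsLinkChain.exists_isTop (hz : G.IsLinkChain C a b m z)
    (hwf : WellFounded (flip G.dir)) {k : ℕ} (hk : k < m) : ∃ u u', G.IsTop C m z k u u' := by
  by_cases h : ∃ w, G.Above C m z k w ∧ G.Above C m z (k + 1) w
  · obtain ⟨w, hw, hmin⟩ := hwf.has_min {w | G.Above C m z k w ∧ G.Above C m z (k + 1) w} h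
    exact ⟨w, w, hw.1, hw.2, .inl ⟨rfl, fun y hy h => hmin y h hy⟩⟩
  · obtain ⟨u, u', h1, h2, h3⟩ := hz.2.2.2 k hk
    have h1' : G.Above C m z k u := ⟨hk.le, h1⟩
    have h2' : G.Above C m z (k + 1) u' := ⟨hk, h2⟩
    refine ⟨u, u', h1', h2', .inr ⟨?_, not_exists.1 h⟩⟩
    rcases h3 with ⟨rfl, -⟩ | h3
    · exact absurd ⟨u, h1', h2'⟩ h
    · exact h3

/-- A choice of tops for a chain, and of children on the directed paths. -/
structure TopSystem (G : MixedGraph V) (C : Finset V) (m : ℕ) (z : ℕ → V) where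
  left : ℕ → V
  right : ℕ → V
  next : ℕ → V → V
  isTop : ∀ k < m, G.IsTop C m z k (left k) (right k)
  dir_next : ∀ i v, G.Above C m z i v → v ≠ z i → G.dir v (next i v)
  above_next : ∀ i v, G.Above C m z i v → v ≠ z i → G.Above C m z i (next i v)
  chordless : G.IsChordless C m z

theorem IsLinkChain.nonempty_topSystem (hz : G.IsLinkChain C a b m z) (hch : G.IsChordless C m z)
    (hwf : WellFounded (flip G.dir)) : Nonempty (G.TopSystem C m z) := by
  classical
  have h1 : ∀ k, ∃ q : V × V, k < m → G.IsTop C m z k q.1 q.2 := fun k => by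
    by_cases hk : k < m
    · obtain ⟨u, u', h⟩ := hz.exists_isTop hwf hk
      exact ⟨(u, u'), fun _ => h⟩
    · exact ⟨(a, a), fun h => absurd h hk⟩
  have h2 : ∀ i v, ∃ y, G.Above C m z i v → v ≠ z i → G.dir v y ∧ G.Above C m z i y := by
    intro i v
    by_cases h : G.Above C m z i v ∧ v ≠ z i
    · obtain ⟨y, hy, hy', -⟩ := h.1.exists_dir h.2
      exact ⟨y, fun _ _ => ⟨hy, hy'⟩⟩
    · exact ⟨v, fun h1 h2 => absurd ⟨h1, h2⟩ h⟩
  choose q hq using h1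
  choose y hy using h2
  exact ⟨⟨fun k => (q k).1, fun k => (q k).2, y, hq, fun i v h h' => (hy i v h h').1,
    fun i v h h' => (hy i v h h').2, hch⟩⟩

namespace TopSystem

variable (T : G.TopSystem C m z)

/-- The vertices above `z i` only. -/
def Only (G : MixedGraph V) (C : Finset V) (m : ℕ) (z : ℕ → V) (i : ℕ) (v : V) : Prop :=
  G.Above C m z i v ∧ ∀ j, G.Above C m z j v → j = i

/-- The vertices with nonzero coefficients. -/
def Active (v : V) : Prop :=
  (∃ i, Only G C m z i v) ∨ ∃ k < m, T.left k = v ∧ T.right k = v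

variable {T}

/-- A vertex above one point only has such a child. A common top is above just two points, and being
lowest it has no child above both. Hence the branches towards different points never meet again. -/
theorem only_next {i : ℕ} {v : V} (hv : T.Active v) (hi : G.Above C m z i v) (hne : v ≠ z i) :
    Only G C m z i (T.next i v) := by
  have hy := T.above_next i v hi hne
  have hd := T.dir_next i v hi hne
  refine ⟨hy, fun j hj => ?_⟩
  obtain ⟨-, -, -, hvC⟩ := hi.exists_dir hne
  have hjv := hj.head hvC hd
  rcases hv with ⟨i', -, h⟩ | ⟨k, hk, hl, hr⟩
  · rw [h i hi, h j hjv]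
  · obtain ⟨h1, h2, ⟨-, h3⟩ | ⟨h3, -⟩⟩ := T.isTop k hk
    · rw [hl] at h1 h3
      rw [hr] at h2
      have key : ∀ i, G.Above C m z i v → i = k ∨ i = k + 1 := by
        intro i hi
        rcases lt_trichotomy i k with h | h | h
        · have := (T.chordless.above_above hi h2 (by omega)).1
          omega
        · exact .inl h
        · exact .inr (T.chordless.above_above h1 hi h).1
      have := h3 _ hd
      rcases key i hi with rfl | rfl <;> rcases key j hjv with rfl | rfl
      · rfl
      · exact absurd ⟨hy, hj⟩ this
      · exact absurd ⟨hj, hy⟩ this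
      · rfl
    · rw [hl, hr] at h3
      exact absurd h3 (G.bidir_irrefl v)

/-- If `z i` is also above a neighbouring point, the top of that link is `z i` itself: otherwise the
top would have a child above `z i`, hence above both points, and would not be lowest. -/
theorem active_end {i : ℕ} (hi : i ≤ m) : T.Active (z i) := by
  have hself : G.Above C m z i (z i) := ⟨hi, .refl⟩
  by_cases h : ∀ j, G.Above C m z j (z i) → j = i
  · exact .inl ⟨i, hself, h⟩
  right
  push Not at h
  obtain ⟨j, hj, hji⟩ := h
  obtain ⟨k, hk, hkij⟩ : ∃ k < m, (k = i ∧ j = k + 1) ∨ (k = j ∧ i = k + 1) := by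
    have := hj.1
    rcases lt_or_gt_of_ne hji with h | h
    · have := (T.chordless.above_above hj hself h).1
      exact ⟨j, by omega, .inr ⟨rfl, this⟩⟩
    · have := (T.chordless.above_above hself hj h).1
      exact ⟨i, by omega, .inl ⟨rfl, this⟩⟩
  refine ⟨k, hk, ?_⟩
  have hboth : ∀ v, G.Above C m z i v → G.Above C m z j v →
      G.Above C m z k v ∧ G.Above C m z (k + 1) v := by
    intro v h1 h2
    rcases hkij with ⟨rfl, rfl⟩ | ⟨rfl, rfl⟩
    · exact ⟨h1, h2⟩
    · exact ⟨h2, h1⟩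
  obtain ⟨h1, h2, ⟨h3, h4⟩ | ⟨-, h3⟩⟩ := T.isTop k hk
  · rw [← h3] at h2 ⊢
    have hl : G.Above C m z i (T.left k) := by
      rcases hkij with ⟨rfl, rfl⟩ | ⟨rfl, rfl⟩
      · exact h1
      · exact h2
    have : T.left k = z i := by
      by_contra hne
      obtain ⟨y, hy, hyi, -⟩ := hl.exists_dir hne
      exact h4 y hy (hboth y hyi ⟨hj.1, hyi.2.trans hj.2⟩)
    exact ⟨this, this⟩
  · exact absurd (hboth _ hself hj) (h3 _)

theorem active_left {k : ℕ} (hk : k < m) : T.Active (T.left k) := by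
  obtain ⟨h1, h2, ⟨h3, -⟩ | ⟨h3, h4⟩⟩ := T.isTop k hk
  · exact .inr ⟨k, hk, rfl, h3.symm⟩
  · refine .inl ⟨k, h1, fun j hj => ?_⟩
    rcases lt_trichotomy j k with h | h | h
    · exact (T.chordless.not_above_of_bidir hj h2 h3 (by omega)).elim
    · exact h
    · have := (T.chordless.above_above h1 hj h).1
      exact absurd ⟨h1, this ▸ hj⟩ (h4 _)

theorem active_right {k : ℕ} (hk : k < m) : T.Active (T.right k) := by
  obtain ⟨h1, h2, ⟨h3, -⟩ | ⟨h3, h4⟩⟩ := T.isTop k hk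
  · exact .inr ⟨k, hk, h3, rfl⟩
  · refine .inl ⟨k + 1, h2, fun j hj => ?_⟩
    rcases lt_trichotomy j (k + 1) with h | h | h
    · have := (T.chordless.above_above hj h2 h).1
      have : j = k := by omega
      exact absurd ⟨this ▸ hj, h2⟩ (h4 _)
    · exact h
    · exact (T.chordless.not_above_of_bidir h1 hj h3 (by omega)).elim

/-- Together with `above_right_iff`, this says that coordinate `k` of the noise reaches `z k` and `z
(k + 1)` and no other point. -/
theorem above_left_iff {k i : ℕ} (hk : k < m) :
    G.Above C m z i (T.left k) ↔ i = k ∨ (i = k + 1 ∧ T.left k = T.right k) := by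
  obtain ⟨h1, h2, ⟨h3, -⟩ | ⟨h3, h4⟩⟩ := T.isTop k hk
  · constructor
    · intro h
      rcases lt_trichotomy i k with h' | h' | h'
      · have := (T.chordless.above_above h (h3 ▸ h2) (by omega)).1
        omega
      · exact .inl h'
      · exact .inr ⟨(T.chordless.above_above h1 h h').1, h3⟩
    · rintro (rfl | ⟨rfl, -⟩)
      · exact h1
      · exact h3 ▸ h2
  · have hne : T.left k ≠ T.right k := fun h => G.bidir_irrefl _ (h ▸ h3)
    simp only [hne, and_false, or_false]
    constructor
    · intro h
      rcases lt_trichotomy i k with h' | h' | h'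
      · exact (T.chordless.not_above_of_bidir h h2 h3 (by omega)).elim
      · exact h'
      · have := (T.chordless.above_above h1 h h').1
        exact absurd ⟨h1, this ▸ h⟩ (h4 _)
    · rintro rfl
      exact h1

theorem above_right_iff {k i : ℕ} (hk : k < m) :
    G.Above C m z i (T.right k) ↔ i = k + 1 ∨ (i = k ∧ T.left k = T.right k) := by
  obtain ⟨h1, h2, ⟨h3, -⟩ | ⟨h3, h4⟩⟩ := T.isTop k hk
  · rw [← h3, above_left_iff hk]
    simp only [← h3, and_true]
    exact or_comm
  · have hne : T.left k ≠ T.right k := fun h => G.bidir_irrefl _ (h ▸ h3)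
    simp only [hne, and_false, or_false]
    constructor
    · intro h
      rcases lt_trichotomy i (k + 1) with h' | h' | h'
      · have := (T.chordless.above_above h h2 h').1
        have : i = k := by omega
        exact absurd ⟨this ▸ h, h2⟩ (h4 _)
      · exact h'
      · exact (T.chordless.not_above_of_bidir h1 h h3 (by omega)).elim
    · rintro rfl
      exact h2

variable (T)

open Classical in
/-- The noise vectors of the model of a system of tops. -/
noncomputable def noise (v : V) (k : Fin m) : ZMod 2 :=
  if T.left k = v ∨ T.right k = v then 1 else 0

open Classical in
/-- The coefficients of the model of a system of tops. -/
noncomputable def coef (v y : V) : ZMod 2 :=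
  ∑ i ∈ Finset.range (m + 1),
    if (T.Active v ∧ G.Above C m z i v ∧ v ≠ z i) ∧ T.next i v = y then 1 else 0

variable {T}

theorem exists_of_coef_ne_zero {v y : V} (h : T.coef v y ≠ 0) :
    ∃ i, T.Active v ∧ G.Above C m z i v ∧ v ≠ z i ∧ T.next i v = y := by
  classical
  obtain ⟨i, -, hi⟩ := Finset.exists_ne_zero_of_sum_ne_zero h
  obtain ⟨⟨h1, h2, h3⟩, h4⟩ := (ite_ne_right_iff.1 hi).1
  exact ⟨i, h1, h2, h3, h4⟩

theorem exists_model (hwf : WellFounded G.dir) :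
    ∃ M : G.LinearModel (ZMod 2) (Fin m), M.noise = T.noise ∧ M.coef = T.coef := by
  refine exists_linearModel hwf _ _ ?_ ?_
  · intro u v h
    obtain ⟨i, -, h2, h3, rfl⟩ := exists_of_coef_ne_zero h
    exact T.dir_next i u h2 h3
  · intro u v k hu hv huv
    have hu := (ite_ne_right_iff.1 hu).1
    have hv := (ite_ne_right_iff.1 hv).1
    obtain ⟨-, -, ⟨h3, -⟩ | ⟨h3, -⟩⟩ := T.isTop k k.2
    · rw [h3, or_self] at hu hv
      exact absurd (hu.symm.trans hv) huv
    · rcases hu with rfl | rfl <;> rcases hv with rfl | rfl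
      · exact absurd rfl huv
      · exact h3
      · exact G.bidir_symm _ _ h3
      · exact absurd rfl huv

-- An active vertex properly above `z i` passes its vector on once towards `z i`, and what it sends
-- towards other points ends at vertices not above `z i`.
open Classical in
theorem sum_coef {i : ℕ} (hi : i ≤ m) (u : V) :
    ∑ v with Only G C m z i v, T.coef u v =
      if T.Active u ∧ G.Above C m z i u ∧ u ≠ z i then 1 else 0 := by
  simp only [coef]
  rw [Finset.sum_comm]
  have h : ∀ j ∈ Finset.range (m + 1), (∑ v with Only G C m z i v,
      if (T.Active u ∧ G.Above C m z j u ∧ u ≠ z j) ∧ T.next j u = v then (1 : ZMod 2) else 0) =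
      if j = i then (if T.Active u ∧ G.Above C m z i u ∧ u ≠ z i then 1 else 0) else 0 := by
    intro j _
    by_cases hj : T.Active u ∧ G.Above C m z j u ∧ u ≠ z j
    · have ho := only_next hj.1 hj.2.1 hj.2.2
      simp only [eq_true hj, true_and, Finset.sum_ite_eq, Finset.mem_filter, Finset.mem_univ]
      by_cases hji : j = i
      · subst hji
        simp [ho, hj]
      · rw [if_neg fun h => hji (h.2 j ho.1), if_neg hji]
    · simp only [hj, false_and, if_false, Finset.sum_const_zero]
      by_cases hji : j = i
      · subst hji
        simp [hj]
      · simp [hji]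
  rw [Finset.sum_congr rfl h, Finset.sum_ite_eq', if_pos (Finset.mem_range.2 (by omega))]

section

variable {M : G.LinearModel (ZMod 2) (Fin m)} (hn : M.noise = T.noise) (hc : M.coef = T.coef)

include hc

theorem vec_eq_noise_of_not_only {v : V} (h : ∀ i, ¬ Only G C m z i v) :
    M.vec v = M.noise v := by
  rw [M.vec_eq, add_eq_left]
  refine Finset.sum_eq_zero fun u _ => ?_
  by_cases hu : M.coef u v = 0
  · rw [hu, zero_smul]
  · rw [hc] at hu
    obtain ⟨i, h1, h2, h3, rfl⟩ := exists_of_coef_ne_zero hu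
    exact absurd (only_next h1 h2 h3) (h i)

-- Conservation of flow: summing the structural equations over the vertices above `z i` only, the
-- vectors of all active vertices properly above `z i` enter once on the right. They cancel, because
-- a vertex above several points receives nothing and its vector is its noise.
open Classical in
theorem vec_end_eq_sum {i : ℕ} (hi : i ≤ m) :
    M.vec (z i) = ∑ u with T.Active u ∧ G.Above C m z i u, M.noise u := by
  have h1 : ∑ v with Only G C m z i v, M.vec v = ∑ v with Only G C m z i v, M.noise v +
      ∑ u with T.Active u ∧ G.Above C m z i u ∧ u ≠ z i, M.vec u := by
    rw [Finset.sum_congr rfl fun v _ => M.vec_eq v, Finset.sum_add_distrib, Finset.sum_comm, hc]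
    simp_rw [← Finset.sum_smul, sum_coef hi, ite_smul, one_smul, zero_smul]
    rw [← Finset.sum_filter]
  have hsplit : ∀ f : V → Fin m → ZMod 2, ∑ u with T.Active u ∧ G.Above C m z i u, f u =
      ∑ v with Only G C m z i v, f v +
      ∑ v with (T.Active v ∧ G.Above C m z i v) ∧ ¬ Only G C m z i v, f v := by
    intro f
    rw [← Finset.sum_filter_add_sum_filter_not _ (Only G C m z i), Finset.filter_filter,
      Finset.filter_filter]
    congr 2
    ext v
    simp only [Finset.mem_filter, Finset.mem_univ, true_and]
    exact ⟨fun h => h.2, fun h => ⟨⟨.inl ⟨i, h⟩, h.1⟩, h⟩⟩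
  have h2 : ∑ u with T.Active u ∧ G.Above C m z i u, M.vec u =
      M.vec (z i) + ∑ u with T.Active u ∧ G.Above C m z i u ∧ u ≠ z i, M.vec u := by
    rw [← Finset.sum_filter_add_sum_filter_not _ (· = z i), Finset.filter_filter,
      Finset.filter_filter]
    congr 1
    · have : (Finset.univ.filter fun u => (T.Active u ∧ G.Above C m z i u) ∧ u = z i) = {z i} := by
        ext u
        simp only [Finset.mem_filter, Finset.mem_univ, true_and, Finset.mem_singleton]
        refine ⟨fun h => h.2, ?_⟩
        rintro rfl
        exact ⟨⟨active_end hi, hi, .refl⟩, rfl⟩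
      rw [this, Finset.sum_singleton]
    · simp only [and_assoc, ne_eq]
  have h3 : ∑ v with (T.Active v ∧ G.Above C m z i v) ∧ ¬ Only G C m z i v, M.vec v =
      ∑ v with (T.Active v ∧ G.Above C m z i v) ∧ ¬ Only G C m z i v, M.noise v := by
    refine Finset.sum_congr rfl fun v hv => vec_eq_noise_of_not_only hc fun j hj => ?_
    obtain ⟨⟨-, h⟩, hno⟩ := (Finset.mem_filter.1 hv).2
    exact hno (hj.2 i h ▸ hj)
  rw [hsplit, ← h3]
  have h4 := h2.symm.trans (hsplit M.vec)
  rw [h1] at h4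
  have h5 := sub_eq_zero.2 h4
  rw [← sub_eq_zero, ← h5]
  abel

include hn

theorem vec_end {i : ℕ} (hi : i ≤ m) (k : Fin m) :
    M.vec (z i) k = if i = k ∨ i = k + 1 then 1 else 0 := by
  classical
  rw [vec_end_eq_sum hc hi, Finset.sum_apply, hn]
  have hl := above_left_iff (T := T) (i := i) k.2
  have hr := above_right_iff (T := T) (i := i) k.2
  have hal := active_left (T := T) k.2
  have har := active_right (T := T) k.2
  simp only [noise]
  rw [Finset.sum_ite, Finset.sum_const_zero, add_zero, Finset.filter_filter]
  by_cases he : T.left k = T.right k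
  · simp only [← he, or_self, and_true] at hl ⊢
    by_cases h : i = k ∨ i = k + 1
    · have : (Finset.univ.filter fun u => (T.Active u ∧ G.Above C m z i u) ∧ T.left k = u) =
          {T.left k} := by
        ext u
        simp only [Finset.mem_filter, Finset.mem_univ, true_and, Finset.mem_singleton]
        refine ⟨fun h => h.2.symm, ?_⟩
        rintro rfl
        exact ⟨⟨hal, hl.2 h⟩, rfl⟩
      rw [this, if_pos h, Finset.sum_singleton]
    · rw [if_neg h, Finset.sum_eq_zero]
      intro u hu
      obtain ⟨⟨-, hu⟩, rfl⟩ := (Finset.mem_filter.1 hu).2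
      exact absurd (hl.1 hu) h
  · simp only [he, and_false, or_false] at hl hr
    have hdis : ∀ u, (T.Active u ∧ G.Above C m z i u) ∧ (T.left k = u ∨ T.right k = u) ↔
        (u = T.left k ∧ i = k) ∨ (u = T.right k ∧ i = k + 1) := by
      intro u
      constructor
      · rintro ⟨⟨-, h⟩, rfl | rfl⟩
        · exact .inl ⟨rfl, hl.1 h⟩
        · exact .inr ⟨rfl, hr.1 h⟩
      · rintro (⟨rfl, h⟩ | ⟨rfl, h⟩)
        · exact ⟨⟨hal, hl.2 h⟩, .inl rfl⟩
        · exact ⟨⟨har, hr.2 h⟩, .inr rfl⟩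
    simp only [hdis]
    by_cases h1 : i = k
    · have h2 : ¬ i = k + 1 := by omega
      simp [h1, Finset.filter_eq']
    · by_cases h2 : i = k + 1
      · simp [h2, Finset.filter_eq']
      · simp [h1, h2]

theorem vec_eq_zero {c : V} (hcC : c ∈ C) (h : ∀ i ≤ m, c ≠ z i) : M.vec c = 0 := by
  have hab : ∀ i, ¬ G.Above C m z i c := fun i hi => h i hi.1 (hi.eq_of_mem hcC)
  rw [vec_eq_noise_of_not_only hc fun i hi => hab i hi.1, hn]
  ext k
  refine if_neg ?_
  rintro (rfl | rfl)
  · exact hab _ (T.isTop k k.2).1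
  · exact hab _ (T.isTop k k.2).2.1

end

end TopSystem

/-- Vertices that are joined by an m-connecting path are dependent in some linear model. -/
theorem IsLinkChain.exists_model (hwf : WellFounded G.dir) (hwf' : WellFounded (flip G.dir))
    (ha : a ∉ C) (hb : b ∉ C) (hab : a ≠ b)
    (hz : G.IsLinkChain C a b m z) (hch : G.IsChordless C m z) :
    ∃ M : G.LinearModel (ZMod 2) (Fin m),
      M.vec a ∈ spanOf (ZMod 2) M.vec ({b} ∪ C) ∧ M.vec a ∉ spanOf (ZMod 2) M.vec C := by
  obtain ⟨T⟩ := hz.nonempty_topSystem hch hwf'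
  obtain ⟨M, hn, hc⟩ := T.exists_model hwf
  have hend := fun i hi k => TopSystem.vec_end hn hc (i := i) hi k
  have hm : 0 < m := by
    rcases Nat.eq_zero_or_pos m with rfl | h
    · exact absurd (hz.1.symm.trans hz.2.1) hab
    · exact h
  -- Each coordinate is 1 at exactly two points, so modulo 2 the vectors of all points sum to zero,
  -- which expresses the vector of `a` through the others.
  have hcol : ∀ k : Fin m, ∑ i ∈ Finset.range (m + 1), M.vec (z i) k = 0 := by
    intro k
    have hk := k.2
    have : ∀ i ∈ Finset.range (m + 1), M.vec (z i) k =
        (if i = k then 1 else 0) + if i = k + 1 then 1 else 0 := by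
      intro i hi
      rw [hend i (by simpa [Nat.lt_succ_iff] using hi) k]
      by_cases h1 : i = k
      · have : ¬ i = k + 1 := by omega
        simp [h1]
      · simp [h1]
    rw [Finset.sum_congr rfl this, Finset.sum_add_distrib, Finset.sum_ite_eq', Finset.sum_ite_eq',
      if_pos (Finset.mem_range.2 (by omega)), if_pos (Finset.mem_range.2 (by omega))]
    decide
  refine ⟨M, ?_, ?_⟩
  · have hsum : ∑ i ∈ Finset.range (m + 1), M.vec (z i) = 0 := by
      ext k
      rw [Finset.sum_apply, hcol k, Pi.zero_apply]
    rw [Finset.sum_range_succ', hz.1] at hsum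
    rw [← neg_eq_of_add_eq_zero_right hsum]
    refine neg_mem (Submodule.sum_mem _ fun i hi => mem_spanOf ?_)
    have hi := Finset.mem_range.1 hi
    rcases Nat.lt_or_ge (i + 1) m with h | h
    · exact Finset.mem_union_right _ (hz.2.2.1 _ (by omega) h)
    · have : i + 1 = m := by omega
      simp [this, hz.2.1]
  -- The coordinate sum separates: it vanishes at the interior points, which have two ones, and at
  -- the other elements of `C`, whose vectors are zero, but it is 1 at `a`, whose vector is e_0.
  · let ℓ : (Fin m → ZMod 2) →ₗ[ZMod 2] ZMod 2 := ∑ k, LinearMap.proj k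
    have hℓ : ∀ x, ℓ x = ∑ k, x k := fun x => by simp [ℓ]
    have hker : spanOf (ZMod 2) M.vec C ≤ LinearMap.ker ℓ := by
      refine Submodule.span_le.2 ?_
      rintro _ ⟨c, hcC, rfl⟩
      rw [SetLike.mem_coe, LinearMap.mem_ker, hℓ]
      by_cases h : ∃ i ≤ m, c = z i
      · obtain ⟨i, hi, rfl⟩ := h
        have hi0 : i ≠ 0 := by
          rintro rfl
          exact ha (hz.1 ▸ hcC)
        have him : i ≠ m := by
          rintro rfl
          exact hb (hz.2.1 ▸ hcC)
        have h2 : ∀ k : Fin m, M.vec (z i) k =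
            (if k = ⟨i, by omega⟩ then 1 else 0) + if k = ⟨i - 1, by omega⟩ then 1 else 0 := by
          intro k
          rw [hend i hi k]
          simp only [Fin.ext_iff]
          by_cases h1 : i = k
          · have : ¬ (k : ℕ) = k - 1 := by omega
            simp [h1, this]
          · have h1' : ¬ (k : ℕ) = i := fun h => h1 h.symm
            have h3 : i = k + 1 ↔ (k : ℕ) = i - 1 := by omega
            simp [h1, h1', h3]
        rw [Finset.sum_congr rfl fun k _ => h2 k, Finset.sum_add_distrib, Finset.sum_ite_eq',
          Finset.sum_ite_eq']
        simp only [Finset.mem_univ, if_true]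
        decide
      · push Not at h
        rw [TopSystem.vec_eq_zero hn hc hcC h]
        simp
    intro h
    have h0 := hker h
    rw [LinearMap.mem_ker, hℓ, ← hz.1] at h0
    have h2 : ∀ k : Fin m, M.vec (z 0) k = if k = ⟨0, hm⟩ then 1 else 0 := by
      intro k
      rw [hend 0 (Nat.zero_le _) k]
      simp [Fin.ext_iff, eq_comm]
    rw [Finset.sum_congr rfl fun k _ => h2 k, Finset.sum_ite_eq'] at h0
    simp at h0

end Model

theorem model_standardImset_subset {n : ℕ} {G : MixedGraph (Fin n)} (hG : G.IsMAG)
    (hord : G.IsTopologicallyOrdered) : Imset.model G.standardImset ⊆ G.model := by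
  rintro ⟨A, B, C⟩ h
  refine ⟨h.1, ?_⟩
  rintro a ha b hb ⟨p, hp⟩
  obtain ⟨hAB, hAC, hBC⟩ := h.1
  have haC : a ∉ C := Finset.disjoint_left.1 hAC ha
  have hbC : b ∉ C := Finset.disjoint_left.1 hBC hb
  have hab : a ≠ b := fun h => Finset.disjoint_left.1 hAB ha (h ▸ hb)
  obtain ⟨m, z, hz, hch⟩ := exists_isChordless hbC hab (hp.exists_isLinkChain hG haC hbC hab)
  have hwf' : WellFounded (flip G.dir) := Subrelation.wf (fun h => hord.lt h) wellFounded_gt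
  obtain ⟨M, h1, h2⟩ := hz.exists_model hord.wellFounded hwf' haC hbC hab hch
  refine h2 (M.inf_le_of_mem_model hord h ⟨?_, ?_⟩)
  · exact mem_spanOf (Finset.mem_union_left _ ha)
  · exact spanOf_mono (Finset.union_subset_union_left (Finset.singleton_subset_iff.2 hb)) h1

end MixedGraph

theorem mainTheorem3 (n : ℕ) (G : MixedGraph (Fin n)) (hG : G.IsMAG)
    (hord : G.IsTopologicallyOrdered) :
    (G.standardImset = ∑ i : Fin n,
      (Imset.semiElementary {i} (Finset.Iio i \ G.mb i (Finset.Iic i)) (G.mb i (Finset.Iic i)) +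
        ∑ H ∈ G.headsBelow i, ∑ q ∈ G.marginalizations i H,
          (-1 : ℤ) ^ (q.1.card + 1) •
            Imset.semiElementary {i} ((H ∪ G.tail H) \ (q.2 ∪ G.tail q.2 ∪ q.1))
              ((q.2 ∪ G.tail q.2) \ {i}))) ∧
    (∀ i : Fin n,
      Imset.IsTriple {i} (Finset.Iio i \ G.mb i (Finset.Iic i)) (G.mb i (Finset.Iic i)) ∧
      ∀ H ∈ G.headsBelow i, ∀ K H' : Finset (Fin n), G.Marginalizes i H K H' →
        Imset.IsTriple {i} ((H ∪ G.tail H) \ (H' ∪ G.tail H' ∪ K)) ((H' ∪ G.tail H') \ {i})) ∧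
    Imset.model G.standardImset ⊆ G.model := by
  refine ⟨?_, fun i => ⟨MixedGraph.isTriple_mb hord i, fun H hH K H' hKH' => ?_⟩,
    MixedGraph.model_standardImset_subset hG hord⟩
  · rw [MixedGraph.standardImset_eq hord]
    refine Finset.sum_congr rfl fun i _ => congrArg _ ?_
    exact (MixedGraph.sum_headsBelow hord fun B B' K =>
      Imset.semiElementary {i} (B \ (B' ∪ K)) (B' \ {i})).symm
  · rw [MixedGraph.headsBelow_eq] at hH
    have hH := Finset.mem_of_mem_erase hH
    obtain ⟨-, hK, rfl⟩ := (MixedGraph.marginalizes_iff hord hH).1 hKH'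
    rw [MixedGraph.union_tail_headAt hord hH hK]
    exact MixedGraph.isTriple_sdiff (MixedGraph.self_mem_block _ _)
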